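/- Let $0<p<1$. In the saturation model a series-parallel network (a directed multigraph with two distinguished vertices, the source and the sink) grows as follows. The network of size $1$ is a single edge from the source to the sink. Given a network of size $n\ge 1$, one of its $n$ edges is selected with probability proportional to $2-l$, where $l$ is the number of times that this edge has been selected before (so an edge is saturated once it has been selected twice). The selected edge $(x,y)$ is then, with probability $p$, doubled in parallel, i.e. a new edge $(x,y)$ is inserted, or, with probability $1-p$, doubled in series, i.e. it is replaced by an edge $(x,z)$, which inherits the identity and the selection count of the selected edge, and a new edge $(z,y)$, where $z$ is a new vertex; the new edge has selection count $0$. This gives a random network of size $n+1$. Let $D_n$ be the degree of the source in the random network of size $n$ generated in this way. (a) If $0<p\le\frac12$, then $D_n$ converges in distribution, as $n\to\infty$, to a discrete random variable $D$ with $$\mathbb{P}\{D=m\}=\frac{1}{m+1}\binom{2m}{m}p^{m-1}(1-p)^{m+1},\qquad m\ge 1$$ (in particular these numbers sum to $1$). (b) If $\frac12<p<1$, then $$\frac{(2p-1)^2}{p^2}\cdot\frac{D_n}{n^{2p-1}}\xrightarrow{(d)}B\cdot Y,\qquad n\to\infty,$$ where $B$ and $Y$ are independent, $B$ takes the value $1$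 with probability $\frac{2p-1}{p^2}$ and the value $0$ otherwise, and $Y$ has the Mittag-Leffler distribution with parameter $2p-1$. Here the Mittag-Leffler distribution with parameter $\alpha\in(0,1)$ is the probability distribution on $\mathbb{R}$ with moments $\mathbb{E}(Y^r)=\frac{r!}{\Gamma(r\alpha+1)}$ for all integers $r\ge 0$; such a distribution exists for $\alpha=2p-1$ and the limit holds for every $Y$ with these moments. -/

import Mathlib

open MeasureTheory ProbabilityTheory Filter
open scoped ENNReal

/-- A two-terminal directed multigraph with `n` labelled edges (edge `j` goes from `tail j` to
`head j`), together with the number of edges that each edge has attracted so far.  Vertices are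
named by natural numbers; `0` is the source and `1` is the sink.  Every edge except the first one
has been attracted by exactly one earlier edge, so the attraction numbers add up to `n - 1`. -/
structure GrowingNetwork (n : ℕ) where
  tail : Fin n → ℕ
  head : Fin n → ℕ
  attracted : Fin n → ℕ
  sum_attracted : ∑ j, attracted j + 1 = n

namespace GrowingNetwork

/-- Every set of networks is measurable. -/
instance (n : ℕ) : MeasurableSpace (GrowingNetwork n) := ⊤

/-- The network of size `1`: a single edge from the source to the sink. -/
def single : GrowingNetwork 1 where
  tail _ := 0
  head _ := 1
  attracted _ := 0
  sum_attracted := by simp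

theorem sum_attracted_snoc {n : ℕ} (N : GrowingNetwork n) (j : Fin n) :
    ∑ i, (Fin.snoc (Function.update N.attracted j (N.attracted j + 1)) 0 : Fin (n + 1) → ℕ) i + 1
      = n + 1 := by
  have h := N.sum_attracted
  rw [Fin.sum_univ_castSucc]
  simp only [Fin.snoc_castSucc, Fin.snoc_last]
  rw [Finset.sum_update_of_mem (Finset.mem_univ j)]
  rw [← Finset.add_sum_erase _ _ (Finset.mem_univ j), ← Finset.sdiff_singleton_eq_erase] at h
  omega

/-- Parallel doubling of the edge `j = (x, y)`: a new edge `(x, y)` is inserted. -/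
def parallelDouble {n : ℕ} (N : GrowingNetwork n) (j : Fin n) : GrowingNetwork (n + 1) where
  tail := Fin.snoc N.tail (N.tail j)
  head := Fin.snoc N.head (N.head j)
  attracted := Fin.snoc (Function.update N.attracted j (N.attracted j + 1)) 0
  sum_attracted := N.sum_attracted_snoc j

/-- Serial doubling of the edge `j = (x, y)`: it is replaced by `(x, z)`, which keeps the label
`j`, and the new edge `(z, y)`, with `z` a new vertex.  The vertex `n + 1` is new, since a network
grown to size `n ≥ 1` only uses vertices among `0, …, n`. -/
def serialDouble {n : ℕ} (N : GrowingNetwork n) (j : Fin n) : GrowingNetwork (n + 1) where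
  tail := Fin.snoc N.tail (n + 1)
  head := Fin.snoc (Function.update N.head j (n + 1)) (N.head j)
  attracted := Fin.snoc (Function.update N.attracted j (N.attracted j + 1)) 0
  sum_attracted := N.sum_attracted_snoc j

/-- The degree of the source: the number of edges incident with it. -/
def sourceDegree {n : ℕ} (N : GrowingNetwork n) : ℕ :=
  (Finset.univ.filter fun j => N.tail j = 0 ∨ N.head j = 0).card

/-- The selection weight `2 - l` of an edge that has already attracted `l` edges.  An edge with
`l = 2` is saturated and is never selected, so that `l > 2` does not occur during the growth. -/
noncomputable def weight {n : ℕ} (N : GrowingNetwork n) (j : Fin n) : ℝ≥0∞ :=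
  ((2 - N.attracted j : ℕ) : ℝ≥0∞)

theorem tsum_weight_ne_zero {n : ℕ} (N : GrowingNetwork n) : ∑' j, N.weight j ≠ 0 := by
  intro h
  have h2 : ∀ j, 2 ≤ N.attracted j := by
    intro j
    have := ENNReal.tsum_eq_zero.1 h j
    simp only [weight, Nat.cast_eq_zero] at this
    omega
  have h3 := Finset.sum_le_sum (s := Finset.univ) fun j _ => h2 j
  simp only [Finset.sum_const, Finset.card_univ, Fintype.card_fin, smul_eq_mul] at h3
  have := N.sum_attracted
  omega

theorem tsum_weight_ne_top {n : ℕ} (N : GrowingNetwork n) : ∑' j, N.weight j ≠ ∞ := by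
  rw [tsum_fintype]
  exact ENNReal.sum_ne_top.2 fun j _ => ENNReal.natCast_ne_top _

/-- The random edge that attracts the next one: edge `j` is selected with probability
proportional to its weight. -/
noncomputable def selectEdge {n : ℕ} (N : GrowingNetwork n) : PMF (Fin n) :=
  PMF.normalize N.weight N.tsum_weight_ne_zero N.tsum_weight_ne_top

/-- A coin that shows `true` with probability `p` and `false` with probability `1 - p`. -/
noncomputable def coin (p : unitInterval) : PMF Bool :=
  PMF.ofFintype (fun b => ENNReal.ofReal (if b then (p : ℝ) else 1 - p)) (by
    simp [← ENNReal.ofReal_add p.2.1 (sub_nonneg.2 p.2.2)])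

/-- One step of the saturation model: an edge is selected, and then it is doubled in a parallel
way with probability `p` and in a serial way with probability `1 - p`. -/
noncomputable def saturationStep (p : unitInterval) {n : ℕ} (N : GrowingNetwork n) :
    PMF (GrowingNetwork (n + 1)) :=
  N.selectEdge.bind fun j =>
    (coin p).map fun b =>
      if b then N.parallelDouble j else N.serialDouble j

/-- The law of the random network of size `n + 1` generated by the saturation model. -/
noncomputable def saturationModel (p : unitInterval) : (n : ℕ) → PMF (GrowingNetwork (n + 1))
  | 0 => PMF.pure single
  | n + 1 => (saturationModel p n).bind fun N => N.saturationStep p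

end GrowingNetwork

/-- A probability measure on `ℝ` is the Mittag-Leffler distribution with parameter `α` if its
`r`-th moment is `r! / Γ(r α + 1)` for every integer `r ≥ 0`. -/
def IsMittagLeffler (α : ℝ) (ν : ProbabilityMeasure ℝ) : Prop :=
  ∀ r : ℕ, Integrable (fun x : ℝ => x ^ r) (ν : Measure ℝ) ∧
    ∫ x : ℝ, x ^ r ∂(ν : Measure ℝ) = (r.factorial : ℝ) / Real.Gamma (r * α + 1)

theorem two_mul_sub_one_div_sq_mem_unitInterval {p : ℝ} (hp : 1 / 2 < p) :
    (2 * p - 1) / p ^ 2 ∈ unitInterval := by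
  have h : 0 < p ^ 2 := by positivity
  refine ⟨div_nonneg (by linarith) h.le, (div_le_one h).2 ?_⟩
  nlinarith [sq_nonneg (p - 1)]

/-!
The source degree `d` is followed together with the source weight `w`, the total selection weight
of the edges at the source. In the network of size `n + 1`, whose total weight is `n + 2`, an edge
at the source is selected with probability `w / (n + 2)`, and then `(d, w)` moves to
`(d + 1, w + 1)` with probability `p` and to `(d, w - 1)` with probability `1 - p`
(`integral_sourceLaw_succ`). So `(d, w)` is a Markov chain that starts at `(1, 2)`; up to the time
scale, `w` is a nearest-neighbour walk absorbed at `0`, and `d - 1` counts its up-steps.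

The walk always moves on as long as `w ≠ 0` (`tendsto_integral_survivalPotential`), and the
probability that it is absorbed after `m - 1` up-steps is the Catalan number `C m` times
`p ^ (m - 1) * (1 - p) ^ (m + 1)`, by the martingale `absorptionProb` built from ballot numbers.
For `p ≤ 1 / 2` these probabilities sum to one (`hasSum_absorptionProb`), no mass is lost, and
the source degree converges in distribution.

For `p > 1 / 2` let `α = 2 p - 1`. The chain acts on the functions `w ↦ z ^ w` through
`(p z ^ 2 - z + 1 - p) d/dz`, which the substitution `z = (1 + (1 - p) X) / (1 + p X)` turns into
`α X d/dX`. Hence the coefficients of the powers of `X` are eigenfunctions with eigenvalues `k α`,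
and they are polynomials in `w` that satisfy a three-term recurrence (`eigenPoly_eigen`,
`eigenPoly_add_two`). Their means are explicit products, asymptotic to `n ^ (k α)` by Euler's
product for the Gamma function, and the recurrence turns them into the limits of the moments of
`w / n ^ α` (`tendsto_integral_pow_weight`). These are the moments of a multiple of `B * Y`; they
grow slowly enough for the characteristic functions to converge
(`tendsto_charFun_of_tendsto_moments`), and Lévy's continuity theorem applies. Finally
`d - (p / α) w` is a martingale of size `n ^ (α / 2)` in `L²`, so that `d` inherits the limit law.

The Mittag-Leffler distribution itself arises as a limit of the laws of `w / n ^ α`, reweighted by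
the probability that the walk started at `w` is never absorbed: the moments converge, and
Prokhorov's theorem provides a measure with the limiting moments
(`exists_probabilityMeasure_of_tendsto_moments`).
-/

open GrowingNetwork
open scoped Topology

/-! ### Integration against probability mass functions -/

theorem PMF.toMeasure_eq_sum_dirac {α : Type*} [MeasurableSpace α] (μ : PMF α) :
    μ.toMeasure = Measure.sum fun a => μ a • Measure.dirac a := by
  ext s hs
  rw [Measure.sum_apply _ hs, PMF.toMeasure_apply _ hs]
  refine tsum_congr fun a => ?_
  by_cases ha : a ∈ s <;> simp [ha, hs]

theorem PMF.toMeasure_bind_eq {α β : Type*} [MeasurableSpace α] [DiscreteMeasurableSpace α]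
    [MeasurableSpace β] (μ : PMF α) (k : α → PMF β) :
    (μ.bind k).toMeasure = μ.toMeasure.bind fun a => (k a).toMeasure := by
  ext s hs
  rw [PMF.toMeasure_bind_apply _ _ _ hs, Measure.bind_apply hs Measurable.of_discrete.aemeasurable,
    PMF.toMeasure_eq_sum_dirac μ, lintegral_sum_measure]
  simp

theorem PMF.integral_bind {α β : Type*} [MeasurableSpace α] [DiscreteMeasurableSpace α]
    [MeasurableSpace β] (μ : PMF α) (k : α → PMF β) {f : β → ℝ}
    (hf : Integrable f (μ.bind k).toMeasure) :
    ∫ b, f b ∂(μ.bind k).toMeasure = ∫ a, ∫ b, f b ∂(k a).toMeasure ∂μ.toMeasure := by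
  rw [PMF.toMeasure_bind_eq] at hf ⊢
  let κ : Kernel α β := ⟨fun a => (k a).toMeasure, Measurable.of_discrete⟩
  have h := Measure.comp_eq_comp_const_apply (κ := κ) (μ := μ.toMeasure)
  change Integrable f (κ ∘ₘ μ.toMeasure) at hf
  change ∫ b, f b ∂(κ ∘ₘ μ.toMeasure) = _
  rw [h] at hf ⊢
  rw [Kernel.integral_comp hf]
  rfl

namespace GrowingNetwork

instance (n : ℕ) : DiscreteMeasurableSpace (GrowingNetwork n) := ⟨fun _ => trivial⟩

/-! ### The source degree and the source weight -/

/-- The edges that are incident with the source. -/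
def sourceEdges {n : ℕ} (N : GrowingNetwork n) : Finset (Fin n) :=
  Finset.univ.filter fun j => N.tail j = 0 ∨ N.head j = 0

/-- The total selection weight of the edges incident with the source. -/
def sourceWeight {n : ℕ} (N : GrowingNetwork n) : ℕ :=
  ∑ j ∈ N.sourceEdges, (2 - N.attracted j)

/-- No edge is over-saturated and no edge ends in the source: the properties of the networks
generated by the saturation model that make the pair of source degree and source weight a
Markov chain. -/
structure IsRegular {n : ℕ} (N : GrowingNetwork n) : Prop where
  attracted_le : ∀ j, N.attracted j ≤ 2
  head_ne_zero : ∀ j, N.head j ≠ 0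

theorem isRegular_single : single.IsRegular :=
  ⟨fun _ => by simp [single], fun _ => by simp [single]⟩

section Doubling

variable {n : ℕ} {N : GrowingNetwork n} {j : Fin n}

theorem IsRegular.parallelDouble (h : N.IsRegular) (hj : N.attracted j < 2) :
    (N.parallelDouble j).IsRegular := by
  constructor <;> intro i <;> refine Fin.lastCases ?_ (fun i => ?_) i
  · simp [-Fin.snoc_update, GrowingNetwork.parallelDouble]
  · have := h.attracted_le i
    rcases eq_or_ne i j with rfl | hij
    · simp [-Fin.snoc_update, GrowingNetwork.parallelDouble]; omega
    · simpa [-Fin.snoc_update, GrowingNetwork.parallelDouble, hij]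
  · simpa [-Fin.snoc_update, GrowingNetwork.parallelDouble] using h.head_ne_zero j
  · simpa [-Fin.snoc_update, GrowingNetwork.parallelDouble] using h.head_ne_zero i

theorem IsRegular.serialDouble (h : N.IsRegular) (hj : N.attracted j < 2) :
    (N.serialDouble j).IsRegular := by
  constructor <;> intro i <;> refine Fin.lastCases ?_ (fun i => ?_) i
  · simp [-Fin.snoc_update, GrowingNetwork.serialDouble]
  · have := h.attracted_le i
    rcases eq_or_ne i j with rfl | hij
    · simp [-Fin.snoc_update, GrowingNetwork.serialDouble]; omega
    · simpa [-Fin.snoc_update, GrowingNetwork.serialDouble, hij]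
  · simpa [-Fin.snoc_update, GrowingNetwork.serialDouble] using h.head_ne_zero j
  · have := h.head_ne_zero i
    rcases eq_or_ne i j with rfl | hij
    · simp [-Fin.snoc_update, GrowingNetwork.serialDouble]
    · simpa [-Fin.snoc_update, GrowingNetwork.serialDouble, hij]

theorem sourceDegree_eq_sum : N.sourceDegree = ∑ i, if N.tail i = 0 ∨ N.head i = 0 then 1 else 0
    := by
  simp [sourceDegree]

theorem sourceWeight_eq_sum :
    N.sourceWeight = ∑ i, if N.tail i = 0 ∨ N.head i = 0 then 2 - N.attracted i else 0 := by
  rw [sourceWeight, sourceEdges, Finset.sum_filter]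

theorem sourceWeight_le : N.sourceWeight ≤ 2 * N.sourceDegree := by
  rw [sourceWeight_eq_sum, sourceDegree_eq_sum, Finset.mul_sum]
  refine Finset.sum_le_sum fun i _ => ?_
  split_ifs <;> omega

theorem sourceDegree_le : N.sourceDegree ≤ n :=
  (Finset.card_le_univ _).trans (Fintype.card_fin n).le

theorem sourceDegree_parallelDouble (hj : j ∈ N.sourceEdges) :
    (N.parallelDouble j).sourceDegree = N.sourceDegree + 1 := by
  have hj : N.tail j = 0 ∨ N.head j = 0 := by simpa [sourceEdges] using hj
  simp only [sourceDegree_eq_sum, Fin.sum_univ_castSucc, parallelDouble, Fin.snoc_castSucc,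
    Fin.snoc_last, hj, if_true]

theorem sourceDegree_serialDouble (h : N.IsRegular) :
    (N.serialDouble j).sourceDegree = N.sourceDegree := by
  have h0 : ∀ i, Function.update N.head j (n + 1) i ≠ 0 := by
    intro i
    rcases eq_or_ne i j with rfl | hij
    · simp
    · simpa [hij] using h.head_ne_zero i
  simp only [sourceDegree_eq_sum, Fin.sum_univ_castSucc, serialDouble, Fin.snoc_castSucc,
    Fin.snoc_last, h0, h.head_ne_zero, Nat.succ_ne_zero, or_self, if_false, add_zero]

theorem sourceWeight_parallelDouble (hj : j ∈ N.sourceEdges) (hw : N.attracted j < 2) :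
    (N.parallelDouble j).sourceWeight = N.sourceWeight + 1 := by
  have hj : N.tail j = 0 ∨ N.head j = 0 := by simpa [sourceEdges] using hj
  rw [sourceWeight_eq_sum, sourceWeight_eq_sum, Fin.sum_univ_castSucc,
    ← Finset.add_sum_erase _ _ (Finset.mem_univ j),
    ← Finset.add_sum_erase (a := j) Finset.univ _ (Finset.mem_univ j)]
  have : ∀ i ∈ Finset.univ.erase j,
      (Function.update N.attracted j (N.attracted j + 1)) i = N.attracted i := by
    intro i hi
    simp [Finset.ne_of_mem_erase hi]
  simp only [GrowingNetwork.parallelDouble, Fin.snoc_castSucc, Fin.snoc_last, hj, if_true,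
    Function.update_self]
  rw [Finset.sum_congr rfl fun i hi => by rw [this i hi]]
  omega

theorem sourceWeight_serialDouble (h : N.IsRegular) (hj : j ∈ N.sourceEdges)
    (hw : N.attracted j < 2) :
    (N.serialDouble j).sourceWeight = N.sourceWeight - 1 := by
  have hj : N.tail j = 0 := by simpa [sourceEdges, h.head_ne_zero] using hj
  rw [sourceWeight_eq_sum, sourceWeight_eq_sum, Fin.sum_univ_castSucc,
    ← Finset.add_sum_erase _ _ (Finset.mem_univ j),
    ← Finset.add_sum_erase (a := j) Finset.univ _ (Finset.mem_univ j)]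
  have h1 : ∀ i ∈ Finset.univ.erase j,
      (Function.update N.attracted j (N.attracted j + 1)) i = N.attracted i := by
    intro i hi
    simp [Finset.ne_of_mem_erase hi]
  have h2 : ∀ i ∈ Finset.univ.erase j,
      (Function.update N.head j (n + 1)) i = N.head i := by
    intro i hi
    simp [Finset.ne_of_mem_erase hi]
  simp only [GrowingNetwork.serialDouble, Fin.snoc_castSucc, Fin.snoc_last, hj, true_or, if_true,
    Function.update_self]
  rw [Finset.sum_congr rfl fun i hi => by rw [h1 i hi, h2 i hi]]
  simp [h.head_ne_zero]
  omega

theorem sourceDegree_parallelDouble_of_notMem (hj : j ∉ N.sourceEdges) :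
    (N.parallelDouble j).sourceDegree = N.sourceDegree := by
  have hj : ¬ (N.tail j = 0 ∨ N.head j = 0) := by simpa [sourceEdges] using hj
  simp only [sourceDegree_eq_sum, Fin.sum_univ_castSucc, parallelDouble, Fin.snoc_castSucc,
    Fin.snoc_last, hj, if_false, add_zero]

theorem sourceWeight_parallelDouble_of_notMem (hj : j ∉ N.sourceEdges) :
    (N.parallelDouble j).sourceWeight = N.sourceWeight := by
  have hj : ¬ (N.tail j = 0 ∨ N.head j = 0) := by simpa [sourceEdges] using hj
  simp only [sourceWeight_eq_sum, Fin.sum_univ_castSucc, parallelDouble, Fin.snoc_castSucc,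
    Fin.snoc_last, hj, if_false, add_zero]
  refine Finset.sum_congr rfl fun i _ => ?_
  rcases eq_or_ne i j with rfl | hij
  · simp [hj]
  · simp [hij]

theorem sourceWeight_serialDouble_of_notMem (h : N.IsRegular) (hj : j ∉ N.sourceEdges) :
    (N.serialDouble j).sourceWeight = N.sourceWeight := by
  have hj : N.tail j ≠ 0 := by
    simp only [sourceEdges, Finset.mem_filter, not_and, not_or, Finset.mem_univ, true_implies] at hj
    exact hj.1
  simp only [sourceWeight_eq_sum, Fin.sum_univ_castSucc, serialDouble, Fin.snoc_castSucc,
    Fin.snoc_last, h.head_ne_zero, Nat.succ_ne_zero, or_self, if_false, add_zero]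
  refine Finset.sum_congr rfl fun i _ => ?_
  rcases eq_or_ne i j with rfl | hij
  · simp [hj]
  · simp [hij, h.head_ne_zero]

end Doubling

/-- Since the attraction numbers add up to `n - 1`, the total weight of a regular network is
`n + 1`. -/
theorem IsRegular.sum_weight {n : ℕ} {N : GrowingNetwork n} (h : N.IsRegular) :
    ∑ j, (2 - N.attracted j) = n + 1 := by
  have h1 : ∑ j, (2 - N.attracted j) + ∑ j, N.attracted j = 2 * n := by
    rw [← Finset.sum_add_distrib, Finset.sum_congr rfl fun j _ =>
      Nat.sub_add_cancel (h.attracted_le j)]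
    simp [mul_comm]
  have := N.sum_attracted
  omega

theorem IsRegular.selectEdge_apply {n : ℕ} {N : GrowingNetwork n} (h : N.IsRegular) (j : Fin n) :
    (N.selectEdge j).toReal = ((2 - N.attracted j : ℕ) : ℝ) / ((n : ℝ) + 1) := by
  have : ∑' i, N.weight i = ((n + 1 : ℕ) : ℝ≥0∞) := by
    rw [tsum_fintype, ← h.sum_weight]
    simp [weight]
  rw [selectEdge, PMF.normalize_apply, this, weight, ENNReal.toReal_mul, ENNReal.toReal_inv,
    ENNReal.toReal_natCast, ENNReal.toReal_natCast]
  push_cast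
  rfl

theorem attracted_lt_of_mem_support {n : ℕ} {N : GrowingNetwork n} {j : Fin n}
    (hj : j ∈ N.selectEdge.support) : N.attracted j < 2 := by
  rw [selectEdge, PMF.mem_support_normalize_iff, weight] at hj
  have : 2 - N.attracted j ≠ 0 := by exact_mod_cast hj
  omega

theorem isRegular_of_mem_support (p : unitInterval) (n : ℕ) :
    ∀ N ∈ (saturationModel p n).support, N.IsRegular := by
  induction n with
  | zero =>
    intro N hN
    rw [saturationModel, PMF.support_pure, Set.mem_singleton_iff] at hN
    exact hN ▸ isRegular_single
  | succ n ih =>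
    intro N hN
    simp only [saturationModel, saturationStep, PMF.mem_support_bind_iff, PMF.mem_support_map_iff]
      at hN
    obtain ⟨M, hM, j, hj, b, -, rfl⟩ := hN
    have hj := attracted_lt_of_mem_support hj
    cases b
    · exact (ih M hM).serialDouble hj
    · exact (ih M hM).parallelDouble hj

theorem ae_isRegular (p : unitInterval) (n : ℕ) :
    ∀ᵐ N ∂(saturationModel p n).toMeasure, N.IsRegular := by
  rw [ae_iff, PMF.toMeasure_apply_eq_zero_iff _ .of_discrete, Set.disjoint_left]
  exact fun N hN h => h (isRegular_of_mem_support p n N hN)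

/-- The source degree together with the source weight. -/
def sourceState {n : ℕ} (N : GrowingNetwork n) : ℕ × ℕ := (N.sourceDegree, N.sourceWeight)

theorem finite_range_sourceState (n : ℕ) :
    (Set.range (sourceState : GrowingNetwork n → ℕ × ℕ)).Finite := by
  refine ((Set.finite_Iic n).prod (Set.finite_Iic (2 * n))).subset ?_
  rintro _ ⟨N, rfl⟩
  have h1 := N.sourceDegree_le
  have h2 := N.sourceWeight_le
  exact ⟨h1, h2.trans (by omega)⟩

theorem integrable_comp_sourceState {n : ℕ} (μ : Measure (GrowingNetwork n)) [IsFiniteMeasure μ]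
    (f : ℕ × ℕ → ℝ) : Integrable (fun N => f N.sourceState) μ := by
  obtain ⟨C, hC⟩ := ((finite_range_sourceState n).image fun x => ‖f x‖).bddAbove
  exact Integrable.of_bound Measurable.of_discrete.aestronglyMeasurable C
    (ae_of_all _ fun N => hC ⟨_, ⟨N, rfl⟩, rfl⟩)

/-- One step of the saturation model seen from the source: from the state `(d, w)`, an edge at the
source is selected with probability `w / (n + 1)`; then the weight grows by one together with the
degree, with probability `p`, or else it drops by one. -/
theorem IsRegular.integral_saturationStep {n : ℕ} {N : GrowingNetwork n} (h : N.IsRegular)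
    (p : unitInterval) (f : ℕ × ℕ → ℝ) :
    ∫ M, f M.sourceState ∂(N.saturationStep p).toMeasure =
      f N.sourceState + N.sourceWeight / ((n : ℝ) + 1) *
        (p * f (N.sourceDegree + 1, N.sourceWeight + 1)
          + (1 - p) * f (N.sourceDegree, N.sourceWeight - 1) - f N.sourceState) := by
  have hn : (n : ℝ) + 1 ≠ 0 := by positivity
  have hcoin : ∀ j, ∫ M, f M.sourceState ∂((coin p).map fun b =>
      if b then N.parallelDouble j else N.serialDouble j).toMeasure =
      p * f (N.parallelDouble j).sourceState + (1 - p) * f (N.serialDouble j).sourceState := by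
    intro j
    rw [← PMF.toMeasure_map (hf := Measurable.of_discrete),
      integral_map Measurable.of_discrete.aemeasurable
        Measurable.of_discrete.aestronglyMeasurable, PMF.integral_eq_sum]
    simp [coin, ENNReal.toReal_ofReal p.2.1, ENNReal.toReal_ofReal (sub_nonneg.2 p.2.2)]
  rw [saturationStep, PMF.integral_bind _ _ (integrable_comp_sourceState _ f),
    PMF.integral_eq_sum]
  simp_rw [hcoin, h.selectEdge_apply, smul_eq_mul]
  set A : ℝ := p * f (N.sourceDegree + 1, N.sourceWeight + 1)
          + (1 - p) * f (N.sourceDegree, N.sourceWeight - 1) - f N.sourceState with hA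
  have key : ∀ j, ((2 - N.attracted j : ℕ) : ℝ) / ((n : ℝ) + 1) *
      (p * f (N.parallelDouble j).sourceState + (1 - p) * f (N.serialDouble j).sourceState) =
      ((2 - N.attracted j : ℕ) : ℝ) / ((n : ℝ) + 1) * f N.sourceState
        + (if N.tail j = 0 ∨ N.head j = 0 then ((2 - N.attracted j : ℕ) : ℝ) else 0)
          / ((n : ℝ) + 1) * A := by
    intro j
    rcases lt_or_ge (N.attracted j) 2 with hj | hj
    · by_cases hs : j ∈ N.sourceEdges
      · have hs' : N.tail j = 0 ∨ N.head j = 0 := by simpa [sourceEdges] using hs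
        simp only [sourceState, sourceDegree_parallelDouble hs, sourceWeight_parallelDouble hs hj,
          sourceDegree_serialDouble h, sourceWeight_serialDouble h hs hj, hs', if_true, hA]
        ring
      · have hs' : ¬ (N.tail j = 0 ∨ N.head j = 0) := by simpa [sourceEdges] using hs
        simp only [sourceState, sourceDegree_parallelDouble_of_notMem hs,
          sourceWeight_parallelDouble_of_notMem hs,
          sourceDegree_serialDouble h, sourceWeight_serialDouble_of_notMem h hs, hs', if_false]
        ring
    · simp [Nat.sub_eq_zero_of_le hj]
  rw [Finset.sum_congr rfl fun j _ => key j, Finset.sum_add_distrib, ← Finset.sum_mul,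
    ← Finset.sum_mul, ← Finset.sum_div, ← Finset.sum_div]
  have h1 : ∑ j, ((2 - N.attracted j : ℕ) : ℝ) = (n : ℝ) + 1 := by exact_mod_cast h.sum_weight
  have h2 : ∑ j, (if N.tail j = 0 ∨ N.head j = 0 then ((2 - N.attracted j : ℕ) : ℝ) else 0)
      = N.sourceWeight := by
    rw [sourceWeight_eq_sum]; push_cast; rfl
  rw [h1, h2, div_self hn, one_mul]

end GrowingNetwork

/-- The law of the source state in the random network of size `n + 1`. -/
noncomputable def sourceLaw (p : unitInterval) (n : ℕ) : Measure (ℕ × ℕ) :=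
  (saturationModel p n).toMeasure.map sourceState

instance (p : unitInterval) (n : ℕ) : IsProbabilityMeasure (sourceLaw p n) :=
  Measure.isProbabilityMeasure_map Measurable.of_discrete.aemeasurable

theorem integrable_sourceLaw (p : unitInterval) (n : ℕ) (f : ℕ × ℕ → ℝ) :
    Integrable f (sourceLaw p n) :=
  (integrable_map_measure Measurable.of_discrete.aestronglyMeasurable
    Measurable.of_discrete.aemeasurable).2 (integrable_comp_sourceState _ f)

theorem integral_sourceLaw (p : unitInterval) (n : ℕ) (f : ℕ × ℕ → ℝ) :
    ∫ x, f x ∂sourceLaw p n = ∫ N, f N.sourceState ∂(saturationModel p n).toMeasure :=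
  integral_map Measurable.of_discrete.aemeasurable Measurable.of_discrete.aestronglyMeasurable

theorem ae_sourceLaw_le (p : unitInterval) (n : ℕ) : ∀ᵐ x ∂sourceLaw p n, x.2 ≤ 2 * x.1 :=
  (ae_map_iff Measurable.of_discrete.aemeasurable .of_discrete).2
    (ae_of_all _ fun N => N.sourceWeight_le)

theorem integral_sourceLaw_zero (p : unitInterval) (f : ℕ × ℕ → ℝ) :
    ∫ x, f x ∂sourceLaw p 0 = f (1, 2) := by
  rw [integral_sourceLaw, saturationModel, PMF.toMeasure_pure, integral_dirac]
  congr 1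

/-- The forward equation of the chain of source states; the network of size `n + 1` has total
weight `n + 2`. -/
theorem integral_sourceLaw_succ (p : unitInterval) (n : ℕ) (f : ℕ × ℕ → ℝ) :
    ∫ x, f x ∂sourceLaw p (n + 1) = ∫ x, (f x + x.2 / ((n : ℝ) + 2) *
      (p * f (x.1 + 1, x.2 + 1) + (1 - p) * f (x.1, x.2 - 1) - f x)) ∂sourceLaw p n := by
  rw [integral_sourceLaw, integral_sourceLaw, saturationModel,
    PMF.integral_bind _ _ (integrable_comp_sourceState _ f)]
  refine integral_congr_ae ?_
  filter_upwards [ae_isRegular p n] with N hN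
  rw [hN.integral_saturationStep]
  simp only [sourceState]
  push_cast
  ring_nf

/-- A function `f` that satisfies the eigenvalue equation with eigenvalue `c` is multiplied by
`1 + c / (n + 2)` on average in each step. -/
theorem integral_sourceLaw_of_eigen (p : unitInterval) {f : ℕ × ℕ → ℝ} {c : ℝ}
    (hf : ∀ d w : ℕ, w * ((p : ℝ) * f (d + 1, w + 1) + (1 - p) * f (d, w - 1) - f (d, w))
      = c * f (d, w)) (n : ℕ) :
    ∫ x, f x ∂sourceLaw p n = (∏ j ∈ Finset.range n, (1 + c / ((j : ℝ) + 2))) * f (1, 2) := by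
  induction n with
  | zero => simp [integral_sourceLaw_zero]
  | succ n ih =>
    rw [integral_sourceLaw_succ, Finset.prod_range_succ, mul_right_comm, ← ih, ← integral_mul_const]
    congr 1 with ⟨d, w⟩
    have := hf d w
    simp only
    rw [div_mul_eq_mul_div, this]
    ring

/-! ### Absorption of the source state -/

/-- The number of lattice paths with steps `±1` that start at `w`, hit `0` at their end for the
first time, and have `k` up-steps, encoded as a coefficient of a power of the Catalan series. -/
noncomputable def ballotNumber (k w : ℕ) : ℕ := PowerSeries.coeff k (PowerSeries.catalanSeries ^ w)

theorem ballotNumber_zero_right (k : ℕ) : ballotNumber k 0 = if k = 0 then 1 else 0 := by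
  rw [ballotNumber, pow_zero, PowerSeries.coeff_one]

theorem ballotNumber_zero_left (w : ℕ) : ballotNumber 0 w = 1 := by
  simp [ballotNumber, PowerSeries.coeff_zero_eq_constantCoeff]

theorem ballotNumber_succ_succ (k w : ℕ) :
    ballotNumber (k + 1) (w + 1) = ballotNumber k (w + 2) + ballotNumber (k + 1) w := by
  have h : PowerSeries.catalanSeries ^ (w + 1)
      = PowerSeries.catalanSeries ^ (w + 2) * PowerSeries.X + PowerSeries.catalanSeries ^ w := by
    rw [pow_succ]
    nth_rw 2 [← PowerSeries.catalanSeries_sq_mul_X_add_one]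
    ring
  rw [ballotNumber, h, map_add, PowerSeries.coeff_succ_mul_X]
  rfl

theorem ballotNumber_two (k : ℕ) : ballotNumber k 2 = catalan (k + 1) := by
  have h := congrArg (PowerSeries.coeff (k + 1)) PowerSeries.catalanSeries_sq_mul_X_add_one
  rw [map_add, PowerSeries.coeff_succ_mul_X, PowerSeries.coeff_one, if_neg k.succ_ne_zero, add_zero,
    PowerSeries.catalanSeries_coeff] at h
  exact h

/-- The probability that the source degree is finally `m` with all edges at the source saturated,
when the source state is `(d, w)`: exactly `m - d` up-steps and `m - d + w` down-steps are made. -/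
noncomputable def absorptionProb (p : ℝ) (m : ℕ) (x : ℕ × ℕ) : ℝ :=
  if x.1 ≤ m then p ^ (m - x.1) * (1 - p) ^ (m - x.1 + x.2) * ballotNumber (m - x.1) x.2 else 0

theorem absorptionProb_zero_right (p : ℝ) (m d : ℕ) :
    absorptionProb p m (d, 0) = if d = m then 1 else 0 := by
  simp only [absorptionProb, ballotNumber_zero_right]
  rcases lt_trichotomy d m with h | rfl | h
  · simp [h.ne, (Nat.sub_pos_of_lt h).ne']
  · simp
  · simp [h.ne', h.not_ge]

theorem absorptionProb_succ_right (p : ℝ) (m d w : ℕ) :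
    absorptionProb p m (d, w + 1) = p * absorptionProb p m (d + 1, w + 2)
      + (1 - p) * absorptionProb p m (d, w) := by
  simp only [absorptionProb]
  rcases lt_trichotomy d m with h | rfl | h
  · obtain ⟨k, rfl⟩ := Nat.exists_eq_add_of_lt h
    have h1 : d + k + 1 - d = k + 1 := by omega
    have h2 : d + k + 1 - (d + 1) = k := by omega
    rw [if_pos (by omega), if_pos (by omega), if_pos (by omega), h1, h2, ballotNumber_succ_succ]
    push_cast
    ring
  · simp [ballotNumber_zero_left, pow_succ']
  · simp [h.not_ge, (h.trans d.lt_succ_self).not_ge]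

theorem absorptionProb_nonneg {p : ℝ} (hp0 : 0 ≤ p) (hp1 : p ≤ 1) (m : ℕ) (x : ℕ × ℕ) :
    0 ≤ absorptionProb p m x := by
  have := sub_nonneg.2 hp1
  rw [absorptionProb]
  split_ifs <;> positivity

/-- The absorption probability is a martingale along the chain of source states. -/
theorem integral_absorptionProb (p : unitInterval) (m n : ℕ) :
    ∫ x, absorptionProb p m x ∂sourceLaw p n = absorptionProb p m (1, 2) := by
  rw [integral_sourceLaw_of_eigen (c := 0) p ?_ n]
  · simp
  · intro d w
    cases w with
    | zero => simp
    | succ w => rw [absorptionProb_succ_right p m d w, Nat.add_sub_cancel]; ring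

theorem absorptionProb_one_two (p : ℝ) (m : ℕ) :
    absorptionProb p (m + 1) (1, 2) = p ^ m * (1 - p) ^ (m + 2) * catalan (m + 1) := by
  simp [absorptionProb, ballotNumber_two]

/-- `2 ^ w / 4 ^ d` on the states `(d, w)` with `w ≠ 0`, a function that is at least halved
whenever an edge at the source is selected. -/
noncomputable def survivalPotential (x : ℕ × ℕ) : ℝ :=
  if x.2 = 0 then 0 else 2 ^ x.2 / 4 ^ x.1

theorem survivalPotential_nonneg (x : ℕ × ℕ) : 0 ≤ survivalPotential x := by
  rw [survivalPotential]
  split_ifs <;> positivity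

theorem integral_survivalPotential_succ_le (p : unitInterval) (n : ℕ) :
    ∫ x, survivalPotential x ∂sourceLaw p (n + 1) ≤
      Real.exp (-(1 / 2 * (1 / ((n + 1 : ℕ) + 1 : ℝ)))) * ∫ x, survivalPotential x ∂sourceLaw p
          n := by
  have h1 : 1 - 1 / 2 * (1 / ((n : ℝ) + 2)) ≤ Real.exp (-(1 / 2 * (1 / ((n + 1 : ℕ) + 1 : ℝ))))
      := by
    refine le_trans (le_of_eq ?_) (Real.one_sub_le_exp_neg _)
    push_cast; ring_nf
  rw [integral_sourceLaw_succ, ← integral_const_mul]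
  refine integral_mono (integrable_sourceLaw p n _) (integrable_sourceLaw p n _) ?_
  rintro ⟨d, w⟩
  refine le_trans ?_ (mul_le_mul_of_nonneg_right h1 (survivalPotential_nonneg _))
  rcases Nat.eq_zero_or_pos w with rfl | hw
  · simp [survivalPotential]
  obtain ⟨v, rfl⟩ : ∃ v, w = v + 1 := Nat.exists_eq_add_of_le' hw
  have hv : (0 : ℝ) ≤ survivalPotential (d, v + 1) := survivalPotential_nonneg _
  have e1 : survivalPotential (d + 1, v + 1 + 1) = survivalPotential (d, v + 1) / 2 := by
    simp only [survivalPotential, Nat.succ_ne_zero, if_false, pow_succ]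
    ring
  have e2 : survivalPotential (d, v + 1 - 1) ≤ survivalPotential (d, v + 1) / 2 := by
    rw [Nat.add_sub_cancel]
    rcases Nat.eq_zero_or_pos v with rfl | hv0
    · simpa [survivalPotential] using by positivity
    · simp only [survivalPotential, Nat.succ_ne_zero, hv0.ne', if_false, pow_succ]
      exact le_of_eq (by ring)
  simp only
  rw [e1]
  set s := survivalPotential (d, v + 1)
  have h2 : (p : ℝ) * (s / 2) + (1 - p) * survivalPotential (d, v + 1 - 1) - s ≤ - (s / 2) := by
    have := mul_le_mul_of_nonneg_left e2 (sub_nonneg.2 p.2.2)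
    linarith
  have h3 : (1 : ℝ) / (n + 2) ≤ (v + 1 : ℕ) / (n + 2) := by
    gcongr
    push_cast
    linarith [(Nat.cast_nonneg v : (0 : ℝ) ≤ v)]
  have h4 := mul_le_mul_of_nonneg_left h2 (by positivity : (0 : ℝ) ≤ (v + 1 : ℕ) / (n + 2))
  have h5 := mul_le_mul_of_nonneg_right h3 (by positivity : 0 ≤ s / 2)
  linarith

theorem tendsto_integral_survivalPotential (p : unitInterval) :
    Tendsto (fun n => ∫ x, survivalPotential x ∂sourceLaw p n) atTop (𝓝 0) := by
  have hle : ∀ n, ∫ x, survivalPotential x ∂sourceLaw p n ≤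
      Real.exp (1 / 2 - 1 / 2 * ∑ j ∈ Finset.range (n + 1), (1 / ((j : ℝ) + 1))) := by
    intro n
    induction n with
    | zero => norm_num [integral_sourceLaw_zero, survivalPotential]
    | succ n ih =>
      refine (integral_survivalPotential_succ_le p n).trans ?_
      refine (mul_le_mul_of_nonneg_left ih (Real.exp_pos _).le).trans (le_of_eq ?_)
      rw [← Real.exp_add, Finset.sum_range_succ _ (n + 1)]
      congr 1
      ring
  refine squeeze_zero (fun n => integral_nonneg survivalPotential_nonneg) hle ?_
  refine Real.tendsto_exp_atBot.comp (tendsto_atBot_add_const_left _ _ ?_)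
  simp_rw [← neg_mul]
  exact (Real.tendsto_sum_range_one_div_nat_succ_atTop.comp
    (tendsto_add_atTop_nat 1)).const_mul_atTop_of_neg (by norm_num)

/-- The probability that the source has degree `m` with all its edges saturated converges to the
absorption probability: on the states that are not absorbed, the martingale `absorptionProb` is
bounded by a multiple of the survival potential. -/
theorem tendsto_integral_absorbed (p : unitInterval) (m : ℕ) :
    Tendsto (fun n => ∫ x, (if x = (m, 0) then 1 else 0 : ℝ) ∂sourceLaw p n) atTop
      (𝓝 (absorptionProb p m (1, 2))) := by
  obtain ⟨C, hC⟩ := (((Set.finite_Iic m).prod (Set.finite_Iic (2 * m))).image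
    (absorptionProb p m)).bddAbove
  have hbound : ∀ n, |∫ x, (if x = (m, 0) then 1 else 0 : ℝ) ∂sourceLaw p n
      - absorptionProb p m (1, 2)| ≤ |C| * 4 ^ m * ∫ x, survivalPotential x ∂sourceLaw p n := by
    intro n
    rw [← integral_absorptionProb p m n, ← integral_sub (integrable_sourceLaw p n _)
      (integrable_sourceLaw p n _), ← integral_const_mul]
    refine (abs_integral_le_integral_abs).trans (integral_mono_ae (integrable_sourceLaw p n _)
      (integrable_sourceLaw p n _) ?_)
    filter_upwards [ae_sourceLaw_le p n] with ⟨d, w⟩ hdw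
    simp only at hdw ⊢
    rcases Nat.eq_zero_or_pos w with rfl | hw
    · simp [absorptionProb_zero_right, survivalPotential]
    rw [if_neg (by simp [hw.ne']), zero_sub, abs_neg,
      abs_of_nonneg (absorptionProb_nonneg p.2.1 p.2.2 _ _)]
    by_cases hd : d ≤ m
    · have h1 : absorptionProb p m (d, w) ≤ |C| :=
        (hC ⟨(d, w), ⟨hd, by simp only [Set.mem_Iic]; omega⟩, rfl⟩).trans (le_abs_self C)
      have h2 : (1 : ℝ) ≤ 4 ^ m * survivalPotential (d, w) := by
        simp only [survivalPotential, hw.ne', if_false]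
        rw [mul_div_assoc', le_div_iff₀ (by positivity), one_mul]
        calc (4 : ℝ) ^ d ≤ 4 ^ m := pow_le_pow_right₀ (by norm_num) hd
          _ ≤ 4 ^ m * 2 ^ w := le_mul_of_one_le_right (by positivity) (one_le_pow₀ (by norm_num))
      rw [mul_assoc]
      exact h1.trans (le_mul_of_one_le_right (abs_nonneg C) h2)
    · rw [absorptionProb, if_neg hd]
      exact mul_nonneg (by positivity) (survivalPotential_nonneg _)
  rw [tendsto_iff_dist_tendsto_zero]
  refine squeeze_zero (fun n => dist_nonneg) (fun n => (Real.dist_eq _ _).trans_le (hbound n)) ?_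
  simpa using (tendsto_integral_survivalPotential p).const_mul (|C| * 4 ^ m)

/-! ### The limit law of the source degree for `p ≤ 1 / 2` -/

theorem sum_absorptionProb_le_one (p : unitInterval) (n : ℕ) :
    ∑ m ∈ Finset.range n, absorptionProb p m (1, 2) ≤ 1 := by
  refine le_of_tendsto (tendsto_finsetSum _ fun m _ => tendsto_integral_absorbed p m)
    (Eventually.of_forall fun k => ?_)
  rw [← integral_finsetSum _ fun m _ => integrable_sourceLaw p k _]
  calc ∫ x, ∑ m ∈ Finset.range n, (if x = (m, 0) then 1 else 0 : ℝ) ∂sourceLaw p k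
      ≤ ∫ x, (1 : ℝ) ∂sourceLaw p k := by
        refine integral_mono (integrable_sourceLaw p k _) (integrable_sourceLaw p k _) ?_
        rintro ⟨d, w⟩
        simp only [Prod.mk.injEq, ite_and, Finset.sum_ite_eq]
        split_ifs <;> simp
    _ = 1 := by simp

/-- The generating function `S` of the Catalan numbers at `p (1 - p)` solves `S = 1 + p (1 - p) S²`,
whose roots are `1 / p` and `1 / (1 - p)`; for `p ≤ 1 / 2` the smaller one is `1 / (1 - p)`. -/
theorem hasSum_absorptionProb (p : unitInterval) (hp0 : 0 < (p : ℝ)) (hp : (p : ℝ) ≤ 1 / 2) :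
    HasSum (fun m => absorptionProb p m (1, 2)) 1 := by
  have hq0 : 0 < 1 - (p : ℝ) := by linarith
  have hnn : ∀ m, 0 ≤ absorptionProb p m (1, 2) := fun m => absorptionProb_nonneg p.2.1 p.2.2 m _
  have hsum : Summable fun m => absorptionProb p m (1, 2) :=
    summable_of_sum_range_le hnn (sum_absorptionProb_le_one p)
  have h0 : absorptionProb p 0 (1, 2) = 0 := by simp [absorptionProb]
  set x : ℝ := p * (1 - p) with hx
  let c : ℕ → ℝ := fun m => catalan m * x ^ m
  have hc : ∀ m, 0 ≤ c m := fun m => by positivity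
  have hc0 : c 0 = 1 := by simp [c]
  have hcs : ∀ m, absorptionProb p (m + 1) (1, 2) = (1 - p) / p * c (m + 1) := by
    intro m
    rw [absorptionProb_one_two]
    simp only [c, hx, mul_pow, pow_succ]
    field_simp
  have hsum1 : Summable fun m => c (m + 1) := by
    have h := (summable_nat_add_iff 1).2 hsum
    simp_rw [hcs] at h
    exact (summable_mul_left_iff (by positivity)).1 h
  have hcsum : Summable c := (summable_nat_add_iff 1).1 hsum1
  set S := ∑' m, c m with hS
  have hS1 : S = 1 + ∑' m, c (m + 1) := by rw [hS, hcsum.tsum_eq_zero_add, hc0]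
  have hP : ∑' m, absorptionProb p m (1, 2) = (1 - p) / p * (S - 1) := by
    rw [hsum.tsum_eq_zero_add, h0, zero_add, tsum_congr hcs, tsum_mul_left, hS1]
    ring
  have hquad : S = 1 + x * (S * S) := by
    have hn : Summable fun m => ‖c m‖ := by simpa [abs_of_nonneg (hc _)] using hcsum
    rw [hS, tsum_mul_tsum_eq_tsum_sum_antidiagonal_of_summable_norm hn hn, ← tsum_mul_left, ←
        hS, hS1]
    congr 1
    refine tsum_congr fun m => ?_
    simp only [c]
    rw [catalan_succ', pow_succ']
    push_cast
    rw [Finset.sum_mul, Finset.mul_sum]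
    refine Finset.sum_congr rfl fun ij hij => ?_
    rw [← Finset.HasAntidiagonal.mem_antidiagonal.1 hij, pow_add]
    ring
  have hle : ∑' m, absorptionProb p m (1, 2) ≤ 1 :=
    hsum.tsum_le_of_sum_range_le (sum_absorptionProb_le_one p)
  have hroot : (p * S - 1) * ((1 - p) * S - 1) = 0 := by
    rw [hx] at hquad
    linear_combination -hquad
  have hSle : (1 - p) * S ≤ 1 := by
    rw [hP, div_mul_eq_mul_div, div_le_one hp0] at hle
    linarith
  have hSq : (1 - p) * S = 1 := by
    rcases mul_eq_zero.1 hroot with h | h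
    · have hS0 : 0 ≤ S := tsum_nonneg hc
      nlinarith
    · linarith
  have : ∑' m, absorptionProb p m (1, 2) = 1 := by
    rw [hP, div_mul_eq_mul_div, div_eq_one_iff_eq hp0.ne']
    linarith
  exact this ▸ hsum.hasSum

theorem absorptionProb_eq_choose (p : ℝ) {m : ℕ} (hm : 1 ≤ m) :
    absorptionProb p m (1, 2) = 1 / ((m : ℝ) + 1) * ((2 * m).choose m : ℝ) * p ^ (m - 1)
      * (1 - p) ^ (m + 1) := by
  obtain ⟨k, rfl⟩ := Nat.exists_eq_add_of_le' hm
  have h : ((k + 1 : ℕ) + 1 : ℝ) * catalan (k + 1) = ((2 * (k + 1)).choose (k + 1) : ℝ) := by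
    exact_mod_cast succ_mul_catalan_eq_centralBinom (k + 1)
  rw [absorptionProb_one_two, ← h, Nat.add_sub_cancel]
  have : ((k + 1 : ℕ) + 1 : ℝ) ≠ 0 := by positivity
  field_simp

/-- The probability distribution of the final source degree for `p ≤ 1 / 2`. -/
noncomputable def finalDegree (p : unitInterval) (hp0 : 0 < (p : ℝ)) (hp : (p : ℝ) ≤ 1 / 2) :
    PMF ℕ :=
  ⟨fun m => ENNReal.ofReal (absorptionProb p m (1, 2)), by
    have h := hasSum_absorptionProb p hp0 hp
    have h2 := ENNReal.ofReal_tsum_of_nonneg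
      (fun m => absorptionProb_nonneg p.2.1 p.2.2 m _) h.summable
    rw [h.tsum_eq, ENNReal.ofReal_one] at h2
    exact h2 ▸ ENNReal.summable.hasSum⟩

/-- Portmanteau with Fatou's lemma: the point masses of the absorbed states converge, and no mass
is lost in the limit. -/
theorem tendstoInDistribution_sourceDegree (p : unitInterval) (hp0 : 0 < (p : ℝ))
    (hp : (p : ℝ) ≤ 1 / 2) :
    TendstoInDistribution
      (fun (n : ℕ) (N : GrowingNetwork (n + 1)) => (N.sourceDegree : ℝ))
      atTop (fun m : ℕ => (m : ℝ))
      (fun n : ℕ => (saturationModel p n).toMeasure) (finalDegree p hp0 hp).toMeasure where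
  forall_aemeasurable n := Measurable.of_discrete.aemeasurable
  aemeasurable_limit := Measurable.of_discrete.aemeasurable
  tendsto := by
    refine tendsto_of_forall_isOpen_le_liminf_nat' fun G hG => ?_
    have hGm := hG.measurableSet
    simp only [ProbabilityMeasure.coe_mk]
    rw [Measure.map_apply Measurable.of_discrete hGm, PMF.toMeasure_apply _ .of_discrete]
    let a : ℕ → ℕ → ℝ≥0∞ := fun n m => sourceLaw p n {(m, 0)}
    have ha : ∀ m, Tendsto (fun n => a n m) atTop (𝓝 (finalDegree p hp0 hp m)) := by
      intro m
      have h := ENNReal.tendsto_ofReal (tendsto_integral_absorbed p m)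
      refine h.congr fun n => ?_
      have : (fun x : ℕ × ℕ => (if x = (m, 0) then 1 else 0 : ℝ))
          = Set.indicator {(m, 0)} (fun _ => 1) := by
        ext x; simp [Set.indicator_apply]
      rw [this, integral_indicator_const _ .of_discrete, smul_eq_mul, mul_one]
      exact ofReal_measureReal
    set G' : Set ℕ := (fun m : ℕ => (m : ℝ)) ⁻¹' G with hG'
    calc ∑' m, G'.indicator (finalDegree p hp0 hp) m
        = ∫⁻ m, liminf (fun n => G'.indicator (a n) m) atTop ∂Measure.count := by
          rw [lintegral_count]
          refine tsum_congr fun m => (Tendsto.liminf_eq ?_).symm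
          by_cases hm : m ∈ G'
          · simpa [hm] using ha m
          · simp [hm]
      _ ≤ liminf (fun n => ∫⁻ m, G'.indicator (a n) m ∂Measure.count) atTop :=
          lintegral_liminf_le fun n => Measurable.of_discrete
      _ ≤ liminf (fun n => (saturationModel p n).toMeasure.map
            (fun N : GrowingNetwork (n + 1) => (N.sourceDegree : ℝ)) G) atTop := by
          refine liminf_le_liminf (Eventually.of_forall fun n => ?_)
          rw [lintegral_count, Measure.map_apply Measurable.of_discrete hGm]
          calc ∑' m, G'.indicator (a n) m
              = ∑' m, G'.indicator (fun m => sourceLaw p n {(m, 0)}) m := rfl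
            _ ≤ sourceLaw p n {x | x.1 ∈ G'} := by
                rw [← tsum_subtype]
                rw [← measure_iUnion (fun i j hij => by
                  simpa [Subtype.ext_iff] using hij) fun _ => .of_discrete]
                refine measure_mono (Set.iUnion_subset fun m => ?_)
                rintro _ rfl
                exact m.2
            _ = _ := by
                rw [sourceLaw, Measure.map_apply Measurable.of_discrete .of_discrete]
                rfl

/-! ### Polynomial eigenfunctions of the source weight -/

section Eigen

open PowerSeries

/-- The power series `(1 + (1 - p) X) / (1 + p X)`, the substitution that diagonalizes the action of
the chain on the functions `w ↦ z ^ w`. -/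
noncomputable def eigenSeries (p : ℝ) : PowerSeries ℝ := (1 + C (1 - p) * X) * (1 + C p * X)⁻¹

theorem one_add_mul_eigenSeries (p : ℝ) :
    (1 + C p * X) * eigenSeries p = 1 + C (1 - p) * X := by
  rw [eigenSeries, mul_left_comm, PowerSeries.mul_inv_cancel _ (by simp), mul_one]

theorem derivative_eigenSeries (p : ℝ) :
    (1 + C p * X) ^ 2 * d⁄dX ℝ (eigenSeries p) = C (1 - 2 * p) := by
  have h := one_add_mul_eigenSeries p
  have h2 := congrArg (d⁄dX ℝ) h
  simp only [Derivation.leibniz, map_add, Derivation.map_one_eq_zero, smul_eq_mul, derivative_X,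
    derivative_C] at h2
  have e : (C (1 - p) : PowerSeries ℝ) = 1 - C p := by simp
  have e2 : (C (1 - 2 * p) : PowerSeries ℝ) = 1 - 2 * C p := by simp [map_ofNat]
  rw [e] at h h2
  rw [e2]
  linear_combination (1 + C p * X) * h2 - C p * h

theorem eigenSeries_quadratic (p : ℝ) :
    C p * eigenSeries p ^ 2 + C (1 - p) - eigenSeries p
      = C (2 * p - 1) * X * d⁄dX ℝ (eigenSeries p) := by
  have hD : (1 + C p * X : PowerSeries ℝ) ^ 2 ≠ 0 := by
    refine pow_ne_zero _ fun h => ?_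
    simpa using congrArg constantCoeff h
  refine mul_left_cancel₀ hD ?_
  have h := one_add_mul_eigenSeries p
  have h2 := derivative_eigenSeries p
  have e : (C (1 - p) : PowerSeries ℝ) = 1 - C p := by simp
  have e2 : (C (1 - 2 * p) : PowerSeries ℝ) = 1 - 2 * C p := by simp [map_ofNat]
  have e3 : (C (2 * p - 1) : PowerSeries ℝ) = 2 * C p - 1 := by simp [map_ofNat]
  rw [e] at h ⊢
  rw [e2] at h2
  rw [e3]
  linear_combination (C p * ((1 + C p * X) * eigenSeries p + (1 + (1 - C p) * X)) - (1 + C p *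
      X)) * h
    - (2 * C p - 1) * X * h2

theorem derivative_eigenSeries_pow (p : ℝ) (w : ℕ) :
    (1 + C p * X) * (1 + C (1 - p) * X) * d⁄dX ℝ (eigenSeries p ^ w)
      = -(C ((2 * p - 1) * w) * eigenSeries p ^ w) := by
  cases w with
  | zero => simp
  | succ v =>
    rw [Derivation.leibniz_pow, Nat.add_sub_cancel, nsmul_eq_mul, smul_eq_mul,
      ← one_add_mul_eigenSeries]
    have h2 := derivative_eigenSeries p
    have e2 : (C (1 - 2 * p) : PowerSeries ℝ) = 1 - 2 * C p := by simp [map_ofNat]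
    have e3 : (C ((2 * p - 1) * (v + 1 : ℕ)) : PowerSeries ℝ) = (2 * C p - 1) * (v + 1 : ℕ) := by
      simp [map_ofNat]
    rw [e2] at h2
    rw [e3]
    linear_combination (v + 1 : ℕ) * eigenSeries p ^ (v + 1) * h2

/-- The monic polynomials of degree `k` in `w` that are eigenfunctions of the chain, given by their
generating function in `k`. -/
noncomputable def eigenPoly (p : ℝ) (k w : ℕ) : ℝ :=
  (-1) ^ k * k.factorial / (2 * p - 1) ^ k * coeff k (eigenSeries p ^ w)

theorem coeff_X_mul_derivative (f : PowerSeries ℝ) (k : ℕ) :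
    coeff k (X * d⁄dX ℝ f) = k * coeff k f := by
  cases k with
  | zero => simp
  | succ k => rw [coeff_succ_X_mul, coeff_derivative]; push_cast; ring

theorem eigenPoly_eigen (p : ℝ) (k w : ℕ) :
    (w : ℝ) * (p * eigenPoly p k (w + 1) + (1 - p) * eigenPoly p k (w - 1) - eigenPoly p k w)
      = (k * (2 * p - 1)) * eigenPoly p k w := by
  have h : (w : ℝ) * (p * coeff k (eigenSeries p ^ (w + 1))
      + (1 - p) * coeff k (eigenSeries p ^ (w - 1)) - coeff k (eigenSeries p ^ w))
      = (k * (2 * p - 1)) * coeff k (eigenSeries p ^ w) := by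
    cases w with
    | zero => cases k <;> simp [coeff_one]
    | succ v =>
      have h1 : C ((v + 1 : ℕ) : ℝ) * (C p * eigenSeries p ^ (v + 1 + 1)
          + C (1 - p) * eigenSeries p ^ v - eigenSeries p ^ (v + 1))
          = C (2 * p - 1) * (X * d⁄dX ℝ (eigenSeries p ^ (v + 1))) := by
        rw [Derivation.leibniz_pow, Nat.add_sub_cancel, nsmul_eq_mul, smul_eq_mul, map_natCast]
        linear_combination ((v + 1 : ℕ) * eigenSeries p ^ v) * eigenSeries_quadratic p
      have h2 := congrArg (coeff k) h1
      rw [coeff_C_mul, coeff_C_mul, coeff_X_mul_derivative, map_sub, map_add, coeff_C_mul,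
        coeff_C_mul] at h2
      rw [Nat.add_sub_cancel]
      linear_combination h2
  simp only [eigenPoly]
  linear_combination ((-1) ^ k * k.factorial / (2 * p - 1) ^ k) * h

theorem eigenPoly_zero (p : ℝ) (w : ℕ) : eigenPoly p 0 w = 1 := by
  have h : constantCoeff (eigenSeries p) = 1 := by
    have := congrArg constantCoeff (one_add_mul_eigenSeries p)
    simpa using this
  simp [eigenPoly, h]

theorem coeff_eigenSeries_one (p : ℝ) (w : ℕ) :
    coeff 1 (eigenSeries p ^ w) = -((2 * p - 1) * w * coeff 0 (eigenSeries p ^ w)) := by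
  have h := congrArg (coeff 0) (derivative_eigenSeries_pow p w)
  rw [map_neg, coeff_C_mul] at h
  rw [← h]
  simp only [coeff_zero_eq_constantCoeff, map_mul, map_add, map_one, constantCoeff_X, mul_zero,
    add_zero, one_mul]
  rw [← coeff_zero_eq_constantCoeff_apply, coeff_derivative]
  simp

theorem coeff_eigenSeries_add_two (p : ℝ) (k w : ℕ) :
    (k + 2) * coeff (k + 2) (eigenSeries p ^ w) + (k + 1) * coeff (k + 1) (eigenSeries p ^ w)
      + p * (1 - p) * k * coeff k (eigenSeries p ^ w)
      = -((2 * p - 1) * w * coeff (k + 1) (eigenSeries p ^ w)) := by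
  set T := X * d⁄dX ℝ (eigenSeries p ^ w) with hT
  have h1 : T + X * T + C (p * (1 - p)) * (X * (X * T))
      = X * -(C ((2 * p - 1) * w) * eigenSeries p ^ w) := by
    rw [← derivative_eigenSeries_pow, hT]
    simp only [map_mul, map_sub, map_one]
    ring
  have hTk (i : ℕ) : coeff i T = i * coeff i (eigenSeries p ^ w) := by
    rw [hT, coeff_X_mul_derivative]
  have h2 := congrArg (coeff (k + 2)) h1
  simp only [map_add, coeff_C_mul, coeff_succ_X_mul, map_neg, hTk] at h2
  push_cast at h2
  linear_combination h2

theorem eigenPoly_one {p : ℝ} (hp : 2 * p - 1 ≠ 0) (w : ℕ) : eigenPoly p 1 w = w := by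
  have h0 := eigenPoly_zero p w
  simp only [eigenPoly, pow_zero, Nat.factorial_zero, Nat.cast_one, mul_one, div_one, one_mul] at h0
  rw [eigenPoly, coeff_eigenSeries_one, h0]
  simp
  field_simp

theorem eigenPoly_add_two {p : ℝ} (hp : 2 * p - 1 ≠ 0) (k w : ℕ) :
    eigenPoly p (k + 2) w = (w + (k + 1) / (2 * p - 1)) * eigenPoly p (k + 1) w
      - p * (1 - p) * (k + 1) * k / (2 * p - 1) ^ 2 * eigenPoly p k w := by
  have h := coeff_eigenSeries_add_two p k w
  simp only [eigenPoly, Nat.factorial_succ, pow_succ]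
  push_cast
  field_simp
  linear_combination h

theorem eigenPoly_two {p : ℝ} (hp0 : p ≠ 0) (hp : 2 * p - 1 ≠ 0) (k : ℕ) :
    eigenPoly p (k + 1) 2 = (k + 1).factorial * (p / (2 * p - 1)) ^ (k + 1)
      * ((2 * p - 1) / p ^ 2) * ((k + 1) * (2 * p - 1) + 1) := by
  induction k using Nat.strong_induction_on with
  | _ k ih =>
    match k, ih with
    | 0, _ =>
      rw [zero_add, eigenPoly_one hp]
      simp
      field_simp
    | 1, _ =>
      rw [eigenPoly_add_two hp, zero_add, eigenPoly_one hp]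
      simp [Nat.factorial_succ]
      field_simp
      ring
    | k + 2, ih =>
      rw [eigenPoly_add_two hp, ih (k + 1) (by omega), ih k (by omega)]
      simp only [Nat.factorial_succ, pow_succ]
      push_cast
      field_simp
      ring

end Eigen

/-! ### Moments of the source weight for `p > 1 / 2` -/

/-- Euler's product formula for the Gamma function. -/
theorem tendsto_prod_one_add_div (s : ℝ) (hs : 0 ≤ s) :
    Tendsto (fun n : ℕ => (∏ j ∈ Finset.range n, (1 + s / ((j : ℝ) + 2))) / ((n + 1 : ℕ) : ℝ) ^ s)
      atTop (𝓝 (1 / Real.Gamma (s + 2))) := by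
  rcases hs.eq_or_lt with rfl | hs
  · simp
  have hG : Real.Gamma (s + 2) = Real.Gamma s * (s * (s + 1)) := by
    rw [show s + 2 = s + 1 + 1 by ring, Real.Gamma_add_one (by positivity),
      Real.Gamma_add_one hs.ne']
    ring
  have h := (((Real.GammaSeq_tendsto_Gamma s).comp (tendsto_add_atTop_nat 1)).mul_const
    (s * (s + 1))).inv₀ (by have := Real.Gamma_pos_of_pos hs; positivity)
  rw [← hG, inv_eq_one_div] at h
  refine h.congr fun n => ?_
  have h1 : ((n + 1).factorial : ℝ) = ∏ j ∈ Finset.range n, ((j : ℝ) + 2) := by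
    rw [← Finset.prod_range_add_one_eq_factorial, Finset.prod_range_succ']
    push_cast
    simp [add_assoc, one_add_one_eq_two]
  have h2 : ∏ j ∈ Finset.range (n + 1 + 1), (s + j) =
      (∏ j ∈ Finset.range n, (s + j + 2)) * (s * (s + 1)) := by
    rw [Finset.prod_range_succ', Finset.prod_range_succ']
    push_cast
    simp only [add_assoc, one_add_one_eq_two]
    ring
  have h3 : ∏ j ∈ Finset.range n, (1 + s / ((j : ℝ) + 2)) =
      (∏ j ∈ Finset.range n, (s + j + 2)) / ∏ j ∈ Finset.range n, ((j : ℝ) + 2) := by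
    rw [← Finset.prod_div_distrib]
    refine Finset.prod_congr rfl fun j _ => ?_
    field_simp
    ring
  have h4 : 0 < ∏ j ∈ Finset.range n, ((j : ℝ) + 2) := Finset.prod_pos fun j _ => by positivity
  have h5 : 0 < ∏ j ∈ Finset.range n, (s + j + 2) := Finset.prod_pos fun j _ => by positivity
  have h6 : (0 : ℝ) < ((n + 1 : ℕ) : ℝ) ^ s := by positivity
  simp only [Function.comp, Real.GammaSeq, h1, h2, h3]
  field_simp

/-- The limits of the moments of the rescaled source weight. The case `k = 0` is separate, because
the limit law has an atom at `0`. -/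
noncomputable def weightMoment (p : ℝ) (k : ℕ) : ℝ :=
  if k = 0 then 1 else k.factorial * (p / (2 * p - 1)) ^ k * ((2 * p - 1) / p ^ 2)
    / Real.Gamma (k * (2 * p - 1) + 1)

/-- The order of growth `(n + 1) ^ (2 p - 1)` of the source weight in the network of size `n +
1`. -/
noncomputable def growthScale (p : ℝ) (n : ℕ) : ℝ := ((n + 1 : ℕ) : ℝ) ^ (2 * p - 1)

theorem growthScale_pos (p : ℝ) (n : ℕ) : 0 < growthScale p n := by
  unfold growthScale; positivity

theorem tendsto_growthScale {p : ℝ} (hp : 1 / 2 < p) : Tendsto (growthScale p) atTop atTop :=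
  (tendsto_rpow_atTop (by linarith)).comp
    (tendsto_natCast_atTop_atTop.comp (tendsto_add_atTop_nat 1))

theorem tendsto_integral_eigenPoly (p : unitInterval) (hp : 1 / 2 < (p : ℝ)) (k : ℕ) :
    Tendsto (fun n => (∫ x, eigenPoly p k x.2 ∂sourceLaw p n) / growthScale p n ^ k) atTop
      (𝓝 (weightMoment p k)) := by
  have hα : 0 < 2 * (p : ℝ) - 1 := by linarith
  have h := (tendsto_prod_one_add_div (k * (2 * p - 1)) (by positivity)).mul_const
    (eigenPoly p k 2)
  have hlim : 1 / Real.Gamma (k * (2 * p - 1) + 2) * eigenPoly p k 2 = weightMoment p k := by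
    rcases k with _ | k
    · simp [weightMoment, eigenPoly_zero]
    · have h1 : Real.Gamma ((k + 1 : ℕ) * (2 * p - 1) + 2) =
          ((k + 1 : ℕ) * (2 * p - 1) + 1) * Real.Gamma ((k + 1 : ℕ) * (2 * p - 1) + 1) := by
        rw [← Real.Gamma_add_one (by positivity)]
        ring_nf
      have h2 : 0 < Real.Gamma ((k + 1 : ℕ) * (2 * p - 1) + 1) :=
        Real.Gamma_pos_of_pos (by positivity)
      have h3 : (0 : ℝ) < (k + 1 : ℕ) * (2 * p - 1) + 1 := by positivity
      rw [weightMoment, if_neg k.succ_ne_zero, h1, eigenPoly_two (by linarith) hα.ne']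
      push_cast at h2 h3 ⊢
      generalize Real.Gamma ((k + 1) * (2 * p - 1) + 1) = G at *
      generalize ((k : ℝ) + 1) * (2 * p - 1) + 1 = H at *
      have : (p : ℝ) ≠ 0 := by linarith
      field_simp
  rw [hlim] at h
  refine h.congr fun n => ?_
  rw [integral_sourceLaw_of_eigen (f := fun x => eigenPoly p k x.2) (c := k * (2 * p - 1)) p
    fun d w => eigenPoly_eigen p k w]
  have : growthScale p n ^ k = ((n + 1 : ℕ) : ℝ) ^ (k * (2 * (p : ℝ) - 1)) := by
    rw [growthScale, ← Real.rpow_natCast, ← Real.rpow_mul (by positivity), mul_comm]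
  rw [this]
  ring

theorem tendsto_integral_pow_mul_eigenPoly (p : unitInterval) (hp : 1 / 2 < (p : ℝ)) (j k : ℕ) :
    Tendsto (fun n => (∫ x, (x.2 : ℝ) ^ j * eigenPoly p k x.2 ∂sourceLaw p n)
      / growthScale p n ^ (j + k)) atTop (𝓝 (weightMoment p (j + k))) := by
  have hα : 2 * (p : ℝ) - 1 ≠ 0 := by linarith
  induction j generalizing k with
  | zero => simpa using tendsto_integral_eigenPoly p hp k
  | succ j ih =>
    rcases k with _ | k
    · refine (ih 1).congr fun n => ?_
      simp only [eigenPoly_one hα, eigenPoly_zero, mul_one, add_zero, pow_succ]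
    · have hs := (tendsto_growthScale hp).inv_tendsto_atTop
      -- The recurrence turns `w * eigenPoly (k + 1)` into `eigenPoly (k + 2)` up to terms of lower
      -- order of growth.
      have h := ((ih (k + 2)).sub (((ih (k + 1)).mul hs).const_mul ((k + 1) / (2 * (p : ℝ) -
          1)))).add
        ((((ih k).mul hs).mul hs).const_mul ((p : ℝ) * (1 - p) * (k + 1) * k / (2 * (p : ℝ) - 1)
            ^ 2))
      simp only [mul_zero, sub_zero, add_zero] at h
      rw [show j + 1 + (k + 1) = j + (k + 2) by ring]
      refine h.congr fun n => ?_
      have hI : ∫ x, (x.2 : ℝ) ^ (j + 1) * eigenPoly p (k + 1) x.2 ∂sourceLaw p n =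
          (∫ x, (x.2 : ℝ) ^ j * eigenPoly p (k + 2) x.2 ∂sourceLaw p n)
          - (k + 1) / (2 * (p : ℝ) - 1) * (∫ x, (x.2 : ℝ) ^ j * eigenPoly p (k + 1) x.2
              ∂sourceLaw p n)
          + p * (1 - p) * (k + 1) * k / (2 * (p : ℝ) - 1) ^ 2 *
            (∫ x, (x.2 : ℝ) ^ j * eigenPoly p k x.2 ∂sourceLaw p n) := by
        rw [← integral_const_mul, ← integral_const_mul,
          ← integral_sub (integrable_sourceLaw p n _) (integrable_sourceLaw p n _),
          ← integral_add (integrable_sourceLaw p n _) (integrable_sourceLaw p n _)]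
        congr 1 with x
        rw [eigenPoly_add_two hα]
        ring
      rw [hI]
      have := (growthScale_pos p n).ne'
      simp only [Pi.inv_apply, pow_add, pow_one]
      field_simp

/-- The moments of the rescaled source weight converge. -/
theorem tendsto_integral_pow_weight (p : unitInterval) (hp : 1 / 2 < (p : ℝ)) (k : ℕ) :
    Tendsto (fun n => ∫ x, ((x.2 : ℝ) / growthScale p n) ^ k ∂sourceLaw p n) atTop
      (𝓝 (weightMoment p k)) := by
  refine (tendsto_integral_pow_mul_eigenPoly p hp k 0).congr fun n => ?_
  simp only [eigenPoly_zero, mul_one, add_zero, div_pow, integral_div]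

/-- On the scale of growth, the source degree is `p / (2 p - 1)` times the source weight up to an
error that vanishes in `L²`: the difference is a martingale, and its variance grows as slowly
as the mean of the source weight. -/
theorem tendsto_integral_sq_degree_sub_weight (p : unitInterval) (hp : 1 / 2 < (p : ℝ)) :
    Tendsto (fun n => ∫ x, ((x.1 : ℝ) / growthScale p n
      - p / (2 * p - 1) * ((x.2 : ℝ) / growthScale p n)) ^ 2 ∂sourceLaw p n) atTop (𝓝 0) := by
  have hα : 2 * (p : ℝ) - 1 ≠ 0 := by linarith
  -- `u` makes `d - u w` a martingale, and `K w` compensates the growth of its square.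
  set u : ℝ := p / (2 * p - 1) with hu
  set K : ℝ := (p * (1 - u) ^ 2 + (1 - p) * u ^ 2) / (2 * p - 1) with hK
  have hmart : ∀ n, ∫ x, (((x.1 : ℝ) - u * x.2) ^ 2 - K * x.2) ∂sourceLaw p n
      = (1 - u * 2) ^ 2 - K * 2 := by
    intro n
    rw [integral_sourceLaw_of_eigen (f := fun x => ((x.1 : ℝ) - u * x.2) ^ 2 - K * x.2) (c := 0)
        p ?_ n]
    · simp
    · intro d w
      cases w with
      | zero => simp
      | succ v =>
        have h1 : (p : ℝ) = u * (2 * p - 1) := by rw [hu, div_mul_cancel₀ _ hα]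
        have h2 : p * (1 - u) ^ 2 + (1 - p) * u ^ 2 = K * (2 * p - 1) := by
          rw [hK, div_mul_cancel₀ _ hα]
        simp only [Nat.add_sub_cancel]
        push_cast
        linear_combination (v + 1) * h2 + (v + 1) * 2 * ((d : ℝ) - u * (v + 1)) * h1
  have hs := (tendsto_growthScale hp).inv_tendsto_atTop
  have h := ((hs.mul hs).const_mul ((1 - u * 2) ^ 2 - K * 2)).add
    (((tendsto_integral_pow_weight p hp 1).mul hs).const_mul K)
  simp only [mul_zero, add_zero] at h
  refine h.congr fun n => ?_
  have hsn := (growthScale_pos p n).ne'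
  simp only [pow_one, Pi.inv_apply]
  rw [← hmart n, integral_sub (integrable_sourceLaw p n _) (integrable_sourceLaw p n _),
    integral_const_mul, integral_div]
  have : ∀ x : ℕ × ℕ, ((x.1 : ℝ) / growthScale p n - u * ((x.2 : ℝ) / growthScale p n)) ^ 2 =
      ((x.1 : ℝ) - u * x.2) ^ 2 / growthScale p n ^ 2 := by
    intro x; field_simp
  simp_rw [this]
  rw [integral_div]
  field_simp
  ring

/-! ### The method of moments -/

theorem norm_exp_mul_I_sub_sum_le_of_nonneg (n : ℕ) {x : ℝ} (hx : 0 ≤ x) :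
    ‖Complex.exp (x * Complex.I) - ∑ k ∈ Finset.range n, (x * Complex.I) ^ k / k.factorial‖
      ≤ x ^ n / n.factorial := by
  induction n generalizing x with
  | zero => simp [Complex.norm_exp_ofReal_mul_I]
  | succ n ih =>
    let f : ℝ → ℂ := fun y => Complex.exp (y * Complex.I)
      - ∑ k ∈ Finset.range (n + 1), (y * Complex.I) ^ k / k.factorial
    let f' : ℝ → ℂ := fun y => (Complex.exp (y * Complex.I)
      - ∑ k ∈ Finset.range n, (y * Complex.I) ^ k / k.factorial) * Complex.I
    have hid : ∀ y : ℝ, HasDerivAt (fun y : ℝ => (y : ℂ) * Complex.I) Complex.I y := fun y => by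
      simpa using (Complex.ofRealCLM.hasDerivAt (x := y)).mul_const Complex.I
    have hf : ∀ y, HasDerivAt f (f' y) y := by
      intro y
      have h1 : HasDerivAt (fun y : ℝ => ∑ k ∈ Finset.range (n + 1),
          ((y : ℂ) * Complex.I) ^ k / k.factorial)
          (∑ k ∈ Finset.range (n + 1),
            (k * ((y : ℂ) * Complex.I) ^ (k - 1) * Complex.I) / k.factorial) y :=
        HasDerivAt.fun_sum fun k _ => ((hid y).fun_pow k).div_const _
      refine ((hid y).cexp.sub h1).congr_deriv ?_
      simp only [f', Finset.sum_range_succ', sub_mul, Finset.sum_mul, Nat.cast_zero, zero_mul,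
        zero_div, add_zero, Nat.add_sub_cancel]
      congr 1
      refine Finset.sum_congr rfl fun k _ => ?_
      rw [Nat.factorial_succ]
      have : (k.factorial : ℂ) ≠ 0 := by exact_mod_cast k.factorial_ne_zero
      have : ((k : ℂ) + 1) ≠ 0 := by exact_mod_cast k.succ_ne_zero
      push_cast
      field_simp
    refine image_norm_le_of_norm_deriv_right_le_deriv_boundary (a := 0) (b := x) (f := f) (f' := f')
      (B := fun y => y ^ (n + 1) / (n + 1).factorial) (B' := fun y => y ^ n / n.factorial)
      (fun y _ => (hf y).continuousAt.continuousWithinAt) (fun y _ => (hf y).hasDerivWithinAt) ?_ ?_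
      ?_ ⟨hx, le_rfl⟩
    · simp [f, Finset.sum_range_succ']
    · intro y
      refine ((hasDerivAt_pow (n + 1) y).div_const ((n + 1).factorial : ℝ)).congr_deriv ?_
      rw [Nat.factorial_succ, Nat.add_sub_cancel]
      push_cast
      field_simp
    · intro y hy
      simpa [f'] using ih hy.1

theorem norm_exp_mul_I_sub_sum_le (n : ℕ) (x : ℝ) :
    ‖Complex.exp (x * Complex.I) - ∑ k ∈ Finset.range n, (x * Complex.I) ^ k / k.factorial‖
      ≤ |x| ^ n / n.factorial := by
  rcases le_total 0 x with hx | hx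
  · rw [abs_of_nonneg hx]
    exact norm_exp_mul_I_sub_sum_le_of_nonneg n hx
  · have h := norm_exp_mul_I_sub_sum_le_of_nonneg n (neg_nonneg.2 hx)
    rw [abs_of_nonpos hx, ← Complex.norm_conj]
    simpa [← Complex.exp_conj] using h

theorem norm_charFun_sub_sum_le {μ : Measure ℝ} [IsProbabilityMeasure μ]
    (hμ : ∀ k : ℕ, Integrable (fun x : ℝ => x ^ k) μ) (t : ℝ) (n : ℕ) :
    ‖charFun μ t - ∑ k ∈ Finset.range (2 * n),
      ((t : ℂ) * Complex.I) ^ k / k.factorial * ((∫ x, x ^ k ∂μ : ℝ) : ℂ)‖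
      ≤ t ^ (2 * n) / (2 * n).factorial * ∫ x, x ^ (2 * n) ∂μ := by
  have hint : ∀ k ∈ Finset.range (2 * n), Integrable (fun x : ℝ =>
      ((t : ℂ) * Complex.I) ^ k / k.factorial * ((x ^ k : ℝ) : ℂ)) μ := fun k _ =>
    ((hμ k).ofReal).const_mul _
  have hexp : Integrable (fun x : ℝ => Complex.exp (t * x * Complex.I)) μ := by
    refine Integrable.of_bound (by fun_prop) 1 (ae_of_all _ fun x => ?_)
    have := Complex.norm_exp_ofReal_mul_I (t * x)
    push_cast at this
    exact this.le
  have hsum : ∑ k ∈ Finset.range (2 * n),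
      ((t : ℂ) * Complex.I) ^ k / k.factorial * ((∫ x, x ^ k ∂μ : ℝ) : ℂ)
      = ∫ x, ∑ k ∈ Finset.range (2 * n),
        ((t : ℂ) * Complex.I) ^ k / k.factorial * ((x ^ k : ℝ) : ℂ) ∂μ := by
    rw [integral_finsetSum _ hint]
    refine Finset.sum_congr rfl fun k _ => ?_
    rw [integral_const_mul, integral_complex_ofReal]
  rw [charFun_apply_real, hsum, ← integral_sub hexp (integrable_finsetSum _ hint),
    ← integral_const_mul]
  refine norm_integral_le_of_norm_le ((hμ (2 * n)).const_mul _) (ae_of_all _ fun x => ?_)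
  have h := norm_exp_mul_I_sub_sum_le (2 * n) (t * x)
  rw [Even.pow_abs (even_two_mul n), mul_pow, mul_div_right_comm] at h
  refine le_trans (le_of_eq ?_) h
  push_cast
  congr 2
  refine Finset.sum_congr rfl fun k _ => ?_
  ring

/-- The method of moments, for limits whose even moments grow slowly enough for the characteristic
function to be the sum of its Taylor series. -/
theorem tendsto_charFun_of_tendsto_moments {μ : ℕ → Measure ℝ} [∀ n, IsProbabilityMeasure (μ n)]
    {ν : Measure ℝ} [IsProbabilityMeasure ν] {m : ℕ → ℝ}
    (hμ : ∀ n k, Integrable (fun x : ℝ => x ^ k) (μ n))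
    (hμm : ∀ k, Tendsto (fun n => ∫ x, x ^ k ∂μ n) atTop (𝓝 (m k)))
    (hν : ∀ k : ℕ, Integrable (fun x : ℝ => x ^ k) ν) (hνm : ∀ k : ℕ, ∫ x, x ^ k ∂ν = m k)
    (hm : ∀ t : ℝ, Tendsto (fun k : ℕ => t ^ (2 * k) / (2 * k).factorial * m (2 * k)) atTop (𝓝 0))
    (t : ℝ) :
    Tendsto (fun n => charFun (μ n) t) atTop (𝓝 (charFun ν t)) := by
  rw [Metric.tendsto_atTop']
  intro ε hε
  obtain ⟨K, hK⟩ := ((hm t).eventually (gt_mem_nhds (show 0 < ε / 3 by positivity))).exists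
  let T : (ℕ → ℝ) → ℂ := fun a => ∑ k ∈ Finset.range (2 * K),
    ((t : ℂ) * Complex.I) ^ k / k.factorial * (a k : ℂ)
  have hT : Tendsto (fun n => T fun k => ∫ x, x ^ k ∂μ n) atTop (𝓝 (T m)) :=
    tendsto_finsetSum _ fun k _ =>
      ((Complex.continuous_ofReal.tendsto _).comp (hμm k)).const_mul _
  have h1 := (hμm (2 * K)).const_mul (t ^ (2 * K) / (2 * K).factorial)
  have h2 := (Metric.tendsto_atTop'.1 hT) (ε / 3) (by positivity)
  obtain ⟨N1, hN1⟩ := h2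
  obtain ⟨N2, hN2⟩ := eventually_atTop.1 (h1.eventually (gt_mem_nhds hK))
  refine ⟨max N1 N2, fun n hn => ?_⟩
  have e1 := (norm_charFun_sub_sum_le (hμ n) t K).trans_lt (hN2 n ((le_max_right _ _).trans hn.le))
  have e2 := hN1 n ((le_max_left _ _).trans_lt hn)
  have e3 : ‖charFun ν t - T m‖ < ε / 3 := by
    have := norm_charFun_sub_sum_le hν t K
    simp only [hνm] at this
    exact this.trans_lt hK
  rw [← dist_eq_norm] at e1 e3
  rw [dist_comm] at e3
  calc dist (charFun (μ n) t) (charFun ν t)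
      ≤ dist (charFun (μ n) t) (T fun k => ∫ x, x ^ k ∂μ n)
        + dist (T fun k => ∫ x, x ^ k ∂μ n) (T m) + dist (T m) (charFun ν t) := dist_triangle4 _
            _ _ _
    _ < ε / 3 + ε / 3 + ε / 3 := by gcongr
    _ = ε := by ring

/-- The truncation of a real number to the interval `[-R, R]`. -/
def truncate (R x : ℝ) : ℝ := max (-R) (min x R)

theorem continuous_truncate (R : ℝ) : Continuous (truncate R) := by
  unfold truncate; fun_prop

theorem abs_truncate_le {R : ℝ} (hR : 0 ≤ R) (x : ℝ) : |truncate R x| ≤ R := by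
  rw [truncate, abs_le]
  exact ⟨le_max_left _ _, max_le (by linarith) (min_le_right _ _)⟩

theorem truncate_of_abs_le {R x : ℝ} (hx : |x| ≤ R) : truncate R x = x := by
  rw [abs_le] at hx
  rw [truncate, min_eq_left hx.2, max_eq_right hx.1]

theorem abs_truncate_le_abs {R : ℝ} (hR : 0 ≤ R) (x : ℝ) : |truncate R x| ≤ |x| := by
  rcases le_or_gt |x| R with hx | hx
  · rw [truncate_of_abs_le hx]
  · exact (abs_truncate_le hR x).trans hx.le

theorem abs_truncate_pow_sub_le {R : ℝ} (hR : 1 ≤ R) (k : ℕ) (x : ℝ) :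
    |truncate R x ^ k - x ^ k| ≤ 2 * x ^ (2 * (k + 1)) / R := by
  have hR0 : 0 < R := by linarith
  have hnn : 0 ≤ x ^ (2 * (k + 1)) := (even_two_mul _).pow_nonneg x
  rcases le_or_gt |x| R with hx | hx
  · rw [truncate_of_abs_le hx, sub_self, abs_zero]
    positivity
  · have h1 : |truncate R x ^ k - x ^ k| ≤ 2 * |x| ^ k := by
      calc |truncate R x ^ k - x ^ k| ≤ |truncate R x ^ k| + |x ^ k| := abs_sub _ _
        _ ≤ |x| ^ k + |x| ^ k := by
          rw [abs_pow, abs_pow]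
          exact add_le_add_left (pow_le_pow_left₀ (abs_nonneg _) (abs_truncate_le_abs hR0.le x) k) _
        _ = 2 * |x| ^ k := by ring
    refine h1.trans ?_
    rw [le_div_iff₀ hR0, ← Even.pow_abs (even_two_mul _), mul_assoc]
    have hx1 : 1 ≤ |x| := hR.trans hx.le
    gcongr
    calc |x| ^ k * R ≤ |x| ^ k * |x| := by gcongr
      _ = |x| ^ (k + 1) := (pow_succ _ _).symm
      _ ≤ |x| ^ (2 * (k + 1)) := pow_le_pow_right₀ hx1 (by omega)

theorem integral_truncate_pow_le {μ : Measure ℝ} [IsProbabilityMeasure μ] {R : ℝ} (hR : 0 ≤ R)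
    (k : ℕ) (hμ : Integrable (fun x : ℝ => x ^ (2 * k)) μ) :
    ∫ x, truncate R x ^ (2 * k) ∂μ ≤ ∫ x, x ^ (2 * k) ∂μ := by
  refine integral_mono_of_nonneg (ae_of_all _ fun x => (even_two_mul k).pow_nonneg _) hμ
    (ae_of_all _ fun x => ?_)
  simp only
  rw [← Even.pow_abs (even_two_mul k), ← Even.pow_abs (even_two_mul k) x]
  exact pow_le_pow_left₀ (abs_nonneg _) (abs_truncate_le_abs hR x) _

theorem integrable_truncate_pow (μ : Measure ℝ) [IsProbabilityMeasure μ] {R : ℝ} (hR : 0 ≤ R)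
    (k : ℕ) : Integrable (fun x => truncate R x ^ k) μ :=
  Integrable.of_bound ((continuous_truncate R).pow k).aestronglyMeasurable (R ^ k)
    (ae_of_all _ fun x => by
      rw [Real.norm_eq_abs, abs_pow]
      exact pow_le_pow_left₀ (abs_nonneg _) (abs_truncate_le hR x) _)

theorem abs_integral_truncate_pow_sub_le {μ : Measure ℝ} [IsProbabilityMeasure μ] {R : ℝ}
    (hR : 1 ≤ R) (hμ : ∀ k : ℕ, Integrable (fun x : ℝ => x ^ k) μ) (k : ℕ) :
    |∫ x, truncate R x ^ k ∂μ - ∫ x, x ^ k ∂μ| ≤ 2 * (∫ x, x ^ (2 * (k + 1)) ∂μ) / R := by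
  rw [← integral_sub (integrable_truncate_pow μ (by linarith) k) (hμ k), ← integral_const_mul,
    ← integral_div]
  exact abs_integral_le_integral_abs.trans (integral_mono_of_nonneg
    (ae_of_all _ fun x => abs_nonneg _) (((hμ _).const_mul 2).div_const R)
    (ae_of_all _ fun x => abs_truncate_pow_sub_le hR k x))

theorem isTightMeasureSet_of_integral_sq_le {S : Set (Measure ℝ)} {C : ℝ}
    (hS : ∀ μ ∈ S, Integrable (fun x : ℝ => x ^ 2) μ ∧ ∫ x, x ^ 2 ∂μ ≤ C) : IsTightMeasureSet S
        := by
  refine isTightMeasureSet_of_tendsto_measure_norm_gt ?_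
  have hlim : Tendsto (fun r : ℝ => ENNReal.ofReal (C / r ^ 2)) atTop (𝓝 0) := by
    rw [← ENNReal.ofReal_zero]
    exact ENNReal.tendsto_ofReal ((tendsto_const_nhds (x := C)).div_atTop
      (tendsto_pow_atTop two_ne_zero))
  refine tendsto_of_tendsto_of_tendsto_of_le_of_le' tendsto_const_nhds hlim
    (Eventually.of_forall fun _ => zero_le) ?_
  filter_upwards [eventually_gt_atTop 0] with r hr
  refine iSup₂_le fun μ hμ => ?_
  obtain ⟨hi, hC⟩ := hS μ hμ
  have hr2 : 0 < r ^ 2 := by positivity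
  calc μ {x | r < ‖x‖} ≤ μ {x | ENNReal.ofReal (r ^ 2) ≤ ENNReal.ofReal (x ^ 2)} := by
        refine measure_mono fun x hx => ENNReal.ofReal_le_ofReal ?_
        rw [← sq_abs x]
        exact pow_le_pow_left₀ hr.le (le_of_lt hx) 2
    _ ≤ (∫⁻ x, ENNReal.ofReal (x ^ 2) ∂μ) / ENNReal.ofReal (r ^ 2) :=
        meas_ge_le_lintegral_div (by fun_prop) (by simpa using hr.ne') ENNReal.ofReal_ne_top
    _ = ENNReal.ofReal ((∫ x, x ^ 2 ∂μ) / r ^ 2) := by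
        rw [← ofReal_integral_eq_lintegral_ofReal hi (ae_of_all _ fun x => sq_nonneg x),
          ENNReal.ofReal_div_of_pos hr2]
    _ ≤ ENNReal.ofReal (C / r ^ 2) := by gcongr

/-- Limits of moment sequences are moment sequences: by Prokhorov's theorem, the measures have a
cluster point, and truncation shows that the moments pass to the limit. -/
theorem exists_probabilityMeasure_of_tendsto_moments {μ : ℕ → ProbabilityMeasure ℝ} {m : ℕ → ℝ}
    (hμ : ∀ n k, Integrable (fun x : ℝ => x ^ k) (μ n : Measure ℝ))
    (hμm : ∀ k, Tendsto (fun n => ∫ x, x ^ k ∂(μ n : Measure ℝ)) atTop (𝓝 (m k))) :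
    ∃ ν : ProbabilityMeasure ℝ, ∀ k : ℕ, Integrable (fun x : ℝ => x ^ k) (ν : Measure ℝ) ∧
      ∫ x, x ^ k ∂(ν : Measure ℝ) = m k := by
  obtain ⟨C, hC⟩ := (hμm 2).bddAbove_range
  have htight : IsTightMeasureSet {((ρ : ProbabilityMeasure ℝ) : Measure ℝ) | ρ ∈ Set.range μ} := by
    refine isTightMeasureSet_of_integral_sq_le (C := C) ?_
    rintro _ ⟨_, ⟨n, rfl⟩, rfl⟩
    exact ⟨hμ n 2, hC ⟨n, rfl⟩⟩
  -- A limit along an ultrafilter takes the place of a convergent subsequence.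
  obtain ⟨ν, -, hν⟩ := isCompact_iff_ultrafilter_le_nhds.1
    (isCompact_closure_of_isTightMeasureSet htight) ((hyperfilter ℕ).map μ)
    (le_principal_iff.2 (mem_map.2 (Eventually.of_forall fun n =>
      subset_closure (Set.mem_range_self n))))
  have hle : (hyperfilter ℕ : Filter ℕ) ≤ atTop := Nat.cofinite_eq_atTop ▸ hyperfilter_le_cofinite
  have hν : Tendsto μ (hyperfilter ℕ : Filter ℕ) (𝓝 ν) := hν
  have hm (k : ℕ) := (hμm k).mono_left hle
  have htrunc : ∀ (k : ℕ) {R : ℝ}, 0 ≤ R → Tendsto (fun n => ∫ x, truncate R x ^ k ∂(μ n :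
      Measure ℝ))
      (hyperfilter ℕ : Filter ℕ) (𝓝 (∫ x, truncate R x ^ k ∂(ν : Measure ℝ))) := by
    intro k R hR
    exact ProbabilityMeasure.tendsto_iff_forall_integral_tendsto.1 hν
      (BoundedContinuousFunction.ofNormedAddCommGroup (fun x => truncate R x ^ k)
        ((continuous_truncate R).pow k) (R ^ k) fun x => by
          rw [Real.norm_eq_abs, abs_pow]
          exact pow_le_pow_left₀ (abs_nonneg _) (abs_truncate_le hR x) _)
  have heven : ∀ k : ℕ, ∫⁻ x, ENNReal.ofReal (x ^ (2 * k)) ∂(ν : Measure ℝ)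
      ≤ ENNReal.ofReal (m (2 * k)) := by
    intro k
    -- Fatou's lemma in the truncation level.
    have hpt : ∀ x : ℝ, ENNReal.ofReal (x ^ (2 * k)) =
        liminf (fun R : ℕ => ENNReal.ofReal (truncate R x ^ (2 * k))) atTop := by
      intro x
      refine (Tendsto.liminf_eq (tendsto_const_nhds.congr' ?_)).symm
      filter_upwards [tendsto_natCast_atTop_atTop.eventually_ge_atTop |x|] with R hR
      rw [truncate_of_abs_le hR]
    rw [lintegral_congr hpt]
    refine (lintegral_liminf_le (u := atTop) fun R : ℕ =>
      ((continuous_truncate R).pow (2 * k)).measurable.ennreal_ofReal).trans ?_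
    simp only [Pi.pow_apply]
    refine (liminf_le_liminf (Eventually.of_forall fun R => ?_)).trans
      (liminf_const (ENNReal.ofReal (m (2 * k)))).le
    rw [← ofReal_integral_eq_lintegral_ofReal (integrable_truncate_pow _ R.cast_nonneg _)
      (ae_of_all _ fun x => (even_two_mul k).pow_nonneg _)]
    exact ENNReal.ofReal_le_ofReal (le_of_tendsto_of_tendsto' (htrunc (2 * k) R.cast_nonneg)
      (hm (2 * k)) fun n => integral_truncate_pow_le R.cast_nonneg k (hμ n _))
  have hint_even : ∀ k : ℕ, Integrable (fun x : ℝ => x ^ (2 * k)) (ν : Measure ℝ) := by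
    intro k
    refine ⟨by fun_prop, ?_⟩
    rw [hasFiniteIntegral_iff_ofReal (ae_of_all _ fun x => (even_two_mul k).pow_nonneg _)]
    exact (heven k).trans_lt ENNReal.ofReal_lt_top
  have hint : ∀ k : ℕ, Integrable (fun x : ℝ => x ^ k) (ν : Measure ℝ) := by
    intro k
    refine ((integrable_const (1 : ℝ)).add (hint_even k)).mono' (by fun_prop)
      (ae_of_all _ fun x => ?_)
    rw [Real.norm_eq_abs, Pi.add_apply, two_mul, pow_add, abs_le]
    constructor <;> nlinarith [sq_nonneg (x ^ k - 1), sq_nonneg (x ^ k + 1)]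
  refine ⟨ν, fun k => ⟨hint k, ?_⟩⟩
  set A := 2 * m (2 * (k + 1)) + 2 * ∫ x, x ^ (2 * (k + 1)) ∂(ν : Measure ℝ) with hA
  have hbound : ∀ R : ℝ, 1 ≤ R → |∫ x, x ^ k ∂(ν : Measure ℝ) - m k| ≤ A / R := by
    intro R hR
    have h1 := abs_integral_truncate_pow_sub_le hR hint k
    have h2 : |∫ x, truncate R x ^ k ∂(ν : Measure ℝ) - m k| ≤ 2 * m (2 * (k + 1)) / R :=
      le_of_tendsto_of_tendsto' (((htrunc k (by linarith)).sub (hm k)).abs)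
        (((hm (2 * (k + 1))).const_mul 2).div_const R)
        fun n => abs_integral_truncate_pow_sub_le hR (hμ n) k
    rw [abs_sub_comm] at h1
    refine (abs_sub_le _ _ _).trans ((add_le_add h1 h2).trans (le_of_eq ?_))
    rw [hA]
    ring
  have hzero : |∫ x, x ^ k ∂(ν : Measure ℝ) - m k| ≤ 0 :=
    ge_of_tendsto (tendsto_const_nhds.div_atTop tendsto_id)
      ((eventually_ge_atTop (1 : ℝ)).mono hbound)
  exact sub_eq_zero.1 (abs_nonpos_iff.1 hzero)

/-! ### The limit law of the source degree for `p > 1 / 2` -/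

/-- The moments of the Mittag-Leffler distribution have an everywhere convergent exponential
generating function. -/
theorem tendsto_pow_div_Gamma {α : ℝ} (hα : 0 < α) (t : ℝ) :
    Tendsto (fun k : ℕ => t ^ k / Real.Gamma (k * α + 1)) atTop (𝓝 0) := by
  set M := max 1 |t| with hM
  have hM1 : 1 ≤ M := le_max_left _ _
  set T := M ^ (1 / α) with hT
  have hT1 : 1 ≤ T := Real.one_le_rpow hM1 (by positivity)
  have hfloor : Tendsto (fun k : ℕ => ⌊(k : ℝ) * α⌋₊) atTop atTop :=
    tendsto_nat_floor_atTop.comp (tendsto_natCast_atTop_atTop.atTop_mul_const hα)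
  have hlim : Tendsto (fun k : ℕ => T * (T ^ ⌊(k : ℝ) * α⌋₊ / (⌊(k : ℝ) * α⌋₊).factorial)) atTop
      (𝓝 0) := by
    simpa using ((FloorSemiring.tendsto_pow_div_factorial_atTop T).comp hfloor).const_mul T
  refine squeeze_zero_norm' ?_ hlim
  filter_upwards [hfloor.eventually_ge_atTop 1] with k hk
  set m := ⌊(k : ℝ) * α⌋₊ with hm
  have hmle : (m : ℝ) ≤ k * α := Nat.floor_le (by positivity)
  have hmlt : (k : ℝ) * α < m + 1 := Nat.lt_floor_add_one _
  have hk' : (1 : ℝ) ≤ m := by exact_mod_cast hk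
  have h1 : (m.factorial : ℝ) ≤ Real.Gamma (k * α + 1) := by
    rw [← Real.Gamma_nat_eq_factorial]
    exact Real.Gamma_strictMonoOn_Ici.monotoneOn (Set.mem_Ici.2 (by linarith))
      (Set.mem_Ici.2 (by linarith)) (by linarith)
  have h2 : |t| ^ k ≤ T * T ^ m := by
    calc |t| ^ k ≤ M ^ k := pow_le_pow_left₀ (abs_nonneg t) (le_max_right _ _) k
      _ = T ^ ((k : ℝ) * α) := by
        rw [hT, ← Real.rpow_mul (by linarith), ← Real.rpow_natCast]
        congr 1
        field_simp
      _ ≤ T ^ ((m : ℝ) + 1) := Real.rpow_le_rpow_of_exponent_le hT1 hmlt.le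
      _ = T * T ^ m := by
        rw [Real.rpow_add_one (by linarith), Real.rpow_natCast, mul_comm]
  have h3 : (0 : ℝ) < m.factorial := by positivity
  rw [norm_div, norm_pow, Real.norm_eq_abs, Real.norm_eq_abs,
    abs_of_pos (h3.trans_le h1), ← mul_div_assoc]
  gcongr

/-- The moments of `B * Y`; for `k ≠ 0` they are the moments of `Y` times the probability that `B`
equals `1`. -/
noncomputable def limitMoment (p : ℝ) (k : ℕ) : ℝ :=
  if k = 0 then 1 else (2 * p - 1) / p ^ 2 * (k.factorial / Real.Gamma (k * (2 * p - 1) + 1))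

theorem pow_mul_weightMoment {p : ℝ} (hp0 : p ≠ 0) (hp : 2 * p - 1 ≠ 0) (k : ℕ) :
    ((2 * p - 1) / p) ^ k * weightMoment p k = limitMoment p k := by
  rcases eq_or_ne k 0 with rfl | hk
  · simp [weightMoment, limitMoment]
  · rw [weightMoment, limitMoment, if_neg hk, if_neg hk, div_pow, div_pow]
    field_simp

theorem tendsto_pow_div_factorial_mul_limitMoment {p : ℝ} (hp : 1 / 2 < p) (t : ℝ) :
    Tendsto (fun k : ℕ => t ^ (2 * k) / (2 * k).factorial * limitMoment p (2 * k)) atTop (𝓝 0) := by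
  have h := ((tendsto_pow_div_Gamma (by linarith : 0 < 2 * p - 1) t).comp
    (tendsto_id.const_mul_atTop' two_pos)).const_mul ((2 * p - 1) / p ^ 2)
  rw [mul_zero] at h
  refine h.congr' ?_
  filter_upwards [eventually_ge_atTop 1] with k hk
  rw [limitMoment, if_neg (by omega)]
  simp only [Function.comp, id]
  have : ((2 * k).factorial : ℝ) ≠ 0 := by positivity
  field_simp

theorem integral_bernoulliMeasure_prod_mul_pow {ν : Measure ℝ} [IsProbabilityMeasure ν]
    (r : unitInterval) (k : ℕ) :
    ∫ ω : ℝ × ℝ, (ω.1 * ω.2) ^ k ∂((bernoulliMeasure (1 : ℝ) 0 r).prod ν)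
      = if k = 0 then 1 else r * ∫ y, y ^ k ∂ν := by
  simp_rw [mul_pow]
  rw [integral_prod_mul (fun x : ℝ => x ^ k) (fun y : ℝ => y ^ k), integral_bernoulliMeasure]
  rcases eq_or_ne k 0 with rfl | hk
  · simp
  · simp [hk]

theorem integrable_bernoulliMeasure_prod_mul_pow {ν : Measure ℝ} [IsProbabilityMeasure ν]
    (r : unitInterval) {k : ℕ} (hν : Integrable (fun y : ℝ => y ^ k) ν) :
    Integrable (fun ω : ℝ × ℝ => (ω.1 * ω.2) ^ k) ((bernoulliMeasure (1 : ℝ) 0 r).prod ν) := by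
  simp_rw [mul_pow]
  refine Integrable.mul_prod (f := fun x : ℝ => x ^ k) ?_ hν
  rw [bernoulliMeasure_def]
  exact ((integrable_dirac (by simp)).smul_measure_nnreal).add_measure
    ((integrable_dirac (by simp)).smul_measure_nnreal)

/-- Random variables that are close in `L²` have close characteristic functions. -/
theorem norm_charFun_map_sub_sq_le {Ω : Type*} [MeasurableSpace Ω] {μ : Measure Ω}
    [IsProbabilityMeasure μ] {X Y : Ω → ℝ} (hX : Measurable X) (hY : Measurable Y)
    (h1 : Integrable (fun ω => |X ω - Y ω|) μ) (h2 : Integrable (fun ω => (X ω - Y ω) ^ 2) μ) (t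
        : ℝ) :
    ‖charFun (μ.map X) t - charFun (μ.map Y) t‖ ^ 2 ≤ t ^ 2 * ∫ ω, (X ω - Y ω) ^ 2 ∂μ := by
  have hexp : ∀ Z : Ω → ℝ, Measurable Z →
      Integrable (fun ω => Complex.exp (t * Z ω * Complex.I)) μ := by
    intro Z hZ
    refine Integrable.of_bound (by fun_prop) 1 (ae_of_all _ fun ω => ?_)
    have := Complex.norm_exp_ofReal_mul_I (t * Z ω)
    push_cast at this
    exact this.le
  have hle : ‖charFun (μ.map X) t - charFun (μ.map Y) t‖ ≤ ∫ ω, |t| * |X ω - Y ω| ∂μ := by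
    rw [charFun_apply_real, charFun_apply_real, integral_map hX.aemeasurable (by fun_prop),
      integral_map hY.aemeasurable (by fun_prop), ← integral_sub (hexp X hX) (hexp Y hY)]
    refine norm_integral_le_of_norm_le (h1.const_mul _) (ae_of_all _ fun ω => ?_)
    have e : Complex.exp (t * X ω * Complex.I) - Complex.exp (t * Y ω * Complex.I)
        = Complex.exp ((t * Y ω : ℝ) * Complex.I) *
          (Complex.exp ((t * (X ω - Y ω) : ℝ) * Complex.I) - 1) := by
      rw [mul_sub, ← Complex.exp_add, mul_one]
      push_cast
      ring_nf
    rw [e, norm_mul, Complex.norm_exp_ofReal_mul_I, one_mul, ← abs_mul]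
    simpa using norm_exp_mul_I_sub_sum_le 1 (t * (X ω - Y ω))
  rw [integral_const_mul] at hle
  -- The variance of `|X - Y|` is nonnegative.
  have hvar : (∫ ω, |X ω - Y ω| ∂μ) ^ 2 ≤ ∫ ω, (X ω - Y ω) ^ 2 ∂μ := by
    set c := ∫ ω, |X ω - Y ω| ∂μ with hc
    have h0 : 0 ≤ ∫ ω, ((X ω - Y ω) ^ 2 - 2 * c * |X ω - Y ω| + c ^ 2) ∂μ := by
      refine integral_nonneg fun ω => ?_
      have := sq_nonneg (|X ω - Y ω| - c)
      rw [sub_sq, sq_abs] at this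
      simp only [Pi.zero_apply]
      linarith
    have h3 : Integrable (fun ω => (X ω - Y ω) ^ 2 - 2 * c * |X ω - Y ω|) μ :=
      h2.sub (h1.const_mul _)
    rw [integral_add h3 (integrable_const _), integral_sub h2 (h1.const_mul _),
        integral_const_mul, ← hc] at h0
    simp only [integral_const, probReal_univ, one_smul] at h0
    linarith
  calc ‖charFun (μ.map X) t - charFun (μ.map Y) t‖ ^ 2
      ≤ (|t| * ∫ ω, |X ω - Y ω| ∂μ) ^ 2 := pow_le_pow_left₀ (norm_nonneg _) hle 2
    _ = t ^ 2 * (∫ ω, |X ω - Y ω| ∂μ) ^ 2 := by rw [mul_pow, sq_abs]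
    _ ≤ t ^ 2 * ∫ ω, (X ω - Y ω) ^ 2 ∂μ := by gcongr

/-- The source weight, normalized to have the same limit law as the source degree. -/
noncomputable def scaledWeight (p : unitInterval) (n : ℕ) (x : ℕ × ℕ) : ℝ :=
  (2 * p - 1) / p * ((x.2 : ℝ) / growthScale p n)

/-- The normalized source degree. -/
noncomputable def scaledDegree (p : unitInterval) (n : ℕ) (x : ℕ × ℕ) : ℝ :=
  (2 * (p : ℝ) - 1) ^ 2 / (p : ℝ) ^ 2 * ((x.1 : ℝ) / growthScale p n)

theorem tendsto_integral_scaledWeight_pow (p : unitInterval) (hp : 1 / 2 < (p : ℝ)) (k : ℕ) :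
    Tendsto (fun n => ∫ x, scaledWeight p n x ^ k ∂sourceLaw p n) atTop (𝓝 (limitMoment p k)) := by
  rw [← pow_mul_weightMoment (by linarith) (by linarith)]
  refine ((tendsto_integral_pow_weight p hp k).const_mul _).congr fun n => ?_
  simp only [scaledWeight, mul_pow, integral_const_mul]

theorem tendsto_charFun_scaledWeight (p : unitInterval) (hp : 1 / 2 < (p : ℝ)) {ν :
    ProbabilityMeasure ℝ}
    (hν : IsMittagLeffler (2 * p - 1) ν) (t : ℝ) :
    Tendsto (fun n => charFun ((sourceLaw p n).map (scaledWeight p n)) t) atTop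
      (𝓝 (charFun (((bernoulliMeasure (1 : ℝ) 0 ⟨(2 * (p : ℝ) - 1) / (p : ℝ) ^ 2,
        two_mul_sub_one_div_sq_mem_unitInterval hp⟩).prod (ν : Measure ℝ)).map
          fun ω : ℝ × ℝ => ω.1 * ω.2) t)) := by
  have hmeas : ∀ n, AEMeasurable (scaledWeight p n) (sourceLaw p n) :=
    fun n => Measurable.of_discrete.aemeasurable
  have hmul : AEMeasurable (fun ω : ℝ × ℝ => ω.1 * ω.2) ((bernoulliMeasure (1 : ℝ) 0
      ⟨(2 * (p : ℝ) - 1) / (p : ℝ) ^ 2,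
        two_mul_sub_one_div_sq_mem_unitInterval hp⟩).prod (ν : Measure ℝ)) := by fun_prop
  have := fun n => Measure.isProbabilityMeasure_map (hmeas n)
  have := Measure.isProbabilityMeasure_map hmul
  have hpow : ∀ k : ℕ, Continuous fun x : ℝ => x ^ k := fun k => by fun_prop
  refine tendsto_charFun_of_tendsto_moments (m := limitMoment p) (fun n k => ?_) (fun k => ?_)
    (fun k => ?_) (fun k => ?_) (tendsto_pow_div_factorial_mul_limitMoment hp) t
  · exact (integrable_map_measure (hpow k).aestronglyMeasurable (hmeas n)).2
      (integrable_sourceLaw p n _)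
  · refine (tendsto_integral_scaledWeight_pow p hp k).congr fun n => ?_
    rw [integral_map (hmeas n) (hpow k).aestronglyMeasurable]
  · exact (integrable_map_measure (hpow k).aestronglyMeasurable hmul).2
      (integrable_bernoulliMeasure_prod_mul_pow _ (hν k).1)
  · rw [integral_map hmul (hpow k).aestronglyMeasurable, integral_bernoulliMeasure_prod_mul_pow,
      (hν k).2, limitMoment]

/-- The law of the normalized source degree converges to the law of `B * Y`. -/
theorem tendstoInDistribution_scaledDegree (p : unitInterval) (hp : 1 / 2 < (p : ℝ)) {ν :
    ProbabilityMeasure ℝ}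
    (hν : IsMittagLeffler (2 * p - 1) ν) :
    TendstoInDistribution
      (fun (n : ℕ) (N : GrowingNetwork (n + 1)) =>
        (2 * (p : ℝ) - 1) ^ 2 / (p : ℝ) ^ 2
          * ((N.sourceDegree : ℝ) / ((n + 1 : ℕ) : ℝ) ^ (2 * (p : ℝ) - 1)))
      atTop (fun ω : ℝ × ℝ => ω.1 * ω.2)
      (fun n : ℕ => (saturationModel p n).toMeasure)
      ((bernoulliMeasure (1 : ℝ) 0 ⟨(2 * (p : ℝ) - 1) / (p : ℝ) ^ 2,
        two_mul_sub_one_div_sq_mem_unitInterval hp⟩).prod (ν : Measure ℝ)) where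
  forall_aemeasurable n := Measurable.of_discrete.aemeasurable
  aemeasurable_limit := by fun_prop
  tendsto := by
    refine ProbabilityMeasure.tendsto_of_tendsto_charFun fun t => ?_
    simp only [ProbabilityMeasure.coe_mk]
    have hlaw : ∀ n, (saturationModel p n).toMeasure.map
        (fun N : GrowingNetwork (n + 1) => (2 * (p : ℝ) - 1) ^ 2 / (p : ℝ) ^ 2
          * ((N.sourceDegree : ℝ) / ((n + 1 : ℕ) : ℝ) ^ (2 * (p : ℝ) - 1)))
        = (sourceLaw p n).map (scaledDegree p n) := fun n => by
      rw [sourceLaw, Measure.map_map Measurable.of_discrete Measurable.of_discrete]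
      rfl
    simp_rw [hlaw]
    have hα : 2 * (p : ℝ) - 1 ≠ 0 := by linarith
    have hp0 : (p : ℝ) ≠ 0 := by linarith
    have hdiff : Tendsto (fun n => charFun ((sourceLaw p n).map (scaledDegree p n)) t
        - charFun ((sourceLaw p n).map (scaledWeight p n)) t) atTop (𝓝 0) := by
      have h := ((tendsto_integral_sq_degree_sub_weight p hp).const_mul
        (t ^ 2 * ((2 * (p : ℝ) - 1) ^ 2 / (p : ℝ) ^ 2) ^ 2)).sqrt
      rw [mul_zero, Real.sqrt_zero] at h
      refine squeeze_zero_norm (fun n => Real.le_sqrt_of_sq_le ?_) h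
      refine (norm_charFun_map_sub_sq_le Measurable.of_discrete Measurable.of_discrete
        (integrable_sourceLaw p n _) (integrable_sourceLaw p n _) t).trans (le_of_eq ?_)
      rw [mul_assoc, ← integral_const_mul (((2 * (p : ℝ) - 1) ^ 2 / (p : ℝ) ^ 2) ^ 2)]
      congr 1
      refine integral_congr_ae (ae_of_all _ fun x => ?_)
      simp only
      rw [← mul_pow, scaledDegree, scaledWeight]
      congr 1
      field_simp
    simpa using hdiff.add (tendsto_charFun_scaledWeight p hp hν t)

/-- The Mittag-Leffler distribution is obtained as the limit of the law of the normalized source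
weight `w`, reweighted by the probability `1 - ((1 - p) / p) ^ w` that the weight never vanishes in
the future. -/
theorem exists_isMittagLeffler (p : unitInterval) (hp : 1 / 2 < (p : ℝ)) :
    ∃ ν : ProbabilityMeasure ℝ, IsMittagLeffler (2 * p - 1) ν := by
  have hp0 : 0 < (p : ℝ) := by linarith
  have hα : 0 < 2 * (p : ℝ) - 1 := by linarith
  set ρ : ℝ := (1 - p) / p with hρ
  have hρ0 : 0 ≤ ρ := div_nonneg (sub_nonneg.2 p.2.2) hp0.le
  have hρ1 : ρ < 1 := by rw [hρ, div_lt_one hp0]; linarith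
  set θ : ℝ := 1 - ρ ^ 2 with hθ
  have hθ_eq : θ = (2 * p - 1) / p ^ 2 := by
    rw [hθ, hρ]
    field_simp
    ring
  have hθ0 : 0 < θ := by rw [hθ_eq]; positivity
  -- The function `ρ ^ w` is harmonic, since `ρ` is a root of `p z ^ 2 - z + 1 - p`.
  have hmart : ∀ n, ∫ x, ρ ^ x.2 ∂sourceLaw p n = ρ ^ 2 := by
    intro n
    rw [integral_sourceLaw_of_eigen (f := fun x => ρ ^ x.2) (c := 0) p ?_ n]
    · simp
    · intro d w
      cases w with
      | zero => simp
      | succ w =>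
        have : p * ρ ^ 2 + (1 - p) - ρ = 0 := by rw [hρ]; field_simp; ring
        simp only [Nat.add_sub_cancel]
        linear_combination ((w + 1 : ℕ) * ρ ^ w) * this
  let dens : ℕ × ℕ → ℝ := fun x => (1 - ρ ^ x.2) / θ
  have hdens : ∀ x, 0 ≤ dens x := fun x =>
    div_nonneg (sub_nonneg.2 (pow_le_one₀ hρ0 hρ1.le)) hθ0.le
  let tilted : ℕ → Measure (ℕ × ℕ) := fun n =>
    (sourceLaw p n).withDensity fun x => ENNReal.ofReal (dens x)
  have htilted : ∀ n (f : ℕ × ℕ → ℝ), Integrable f (tilted n) ∧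
      ∫ x, f x ∂tilted n = (∫ x, f x ∂sourceLaw p n - ∫ x, ρ ^ x.2 * f x ∂sourceLaw p n) / θ := by
    intro n f
    constructor
    · exact (integrable_withDensity_iff Measurable.of_discrete
        (ae_of_all _ fun _ => ENNReal.ofReal_lt_top)).2 (integrable_sourceLaw p n _)
    · rw [integral_withDensity_eq_integral_toReal_smul Measurable.of_discrete
        (ae_of_all _ fun _ => ENNReal.ofReal_lt_top),
        ← integral_sub (integrable_sourceLaw p n _) (integrable_sourceLaw p n _), ← integral_div]
      congr 1 with x
      rw [ENNReal.toReal_ofReal (hdens x), smul_eq_mul]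
      ring
  have hprob : ∀ n, IsProbabilityMeasure (tilted n) := by
    intro n
    refine ⟨?_⟩
    rw [withDensity_apply _ .univ, Measure.restrict_univ,
      ← ofReal_integral_eq_lintegral_ofReal (integrable_sourceLaw p n _) (ae_of_all _ hdens),
      integral_div, integral_sub (integrable_sourceLaw p n _) (integrable_sourceLaw p n _), hmart]
    simp [← hθ, hθ0.ne']
  have hmeas : ∀ n, AEMeasurable (scaledWeight p n) (tilted n) :=
    fun n => Measurable.of_discrete.aemeasurable
  have hpow : ∀ k : ℕ, Continuous fun x : ℝ => x ^ k := fun k => by fun_prop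
  refine exists_probabilityMeasure_of_tendsto_moments (μ := fun n =>
    ⟨(tilted n).map (scaledWeight p n), Measure.isProbabilityMeasure_map (hmeas n)⟩)
    (fun n k => ?_) fun k => ?_
  · exact (integrable_map_measure (hpow k).aestronglyMeasurable (hmeas n)).2 (htilted n _).1
  · have hmom : ∀ n, ∫ x, x ^ k ∂(tilted n).map (scaledWeight p n)
        = (∫ x, scaledWeight p n x ^ k ∂sourceLaw p n
          - ∫ x, ρ ^ x.2 * scaledWeight p n x ^ k ∂sourceLaw p n) / θ := fun n => by
      rw [integral_map (hmeas n) (hpow k).aestronglyMeasurable, (htilted n _).2]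
    simp only [ProbabilityMeasure.coe_mk, hmom]
    rcases eq_or_ne k 0 with rfl | hk
    · simp [hmart, ← hθ, hθ0.ne']
    -- Since `ρ ^ w * w ^ k` is bounded, the correction vanishes in the limit.
    obtain ⟨C, hC⟩ := (tendsto_pow_const_mul_const_pow_of_abs_lt_one k
      (by rwa [abs_of_nonneg hρ0] : |ρ| < 1)).bddAbove_range
    have hcorr : Tendsto (fun n => ∫ x, ρ ^ x.2 * scaledWeight p n x ^ k ∂sourceLaw p n) atTop
        (𝓝 0) := by
      have hs := (((tendsto_growthScale hp).inv_tendsto_atTop.pow k).const_mul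
        (((2 * (p : ℝ) - 1) / p) ^ k * C))
      rw [zero_pow hk, mul_zero] at hs
      refine squeeze_zero (fun n => integral_nonneg fun x => ?_) (fun n => ?_) hs
      · have := (growthScale_pos p n).le
        simp only [scaledWeight]
        positivity
      · calc ∫ x, ρ ^ x.2 * scaledWeight p n x ^ k ∂sourceLaw p n
            ≤ ∫ x, ((2 * (p : ℝ) - 1) / p) ^ k * C * (growthScale p n)⁻¹ ^ k ∂sourceLaw p n := by
              refine integral_mono (integrable_sourceLaw p n _) (integrable_sourceLaw p n _)
                fun x => ?_
              have h1 := (growthScale_pos p n)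
              have h2 : (x.2 : ℝ) ^ k * ρ ^ x.2 ≤ C := hC ⟨x.2, rfl⟩
              have e : ρ ^ x.2 * scaledWeight p n x ^ k = ((2 * (p : ℝ) - 1) / p) ^ k
                  * ((x.2 : ℝ) ^ k * ρ ^ x.2) * (growthScale p n)⁻¹ ^ k := by
                rw [scaledWeight, mul_pow, div_pow (x.2 : ℝ), inv_pow]
                ring
              simp only [e]
              gcongr
          _ = ((2 * (p : ℝ) - 1) / p) ^ k * C * ((growthScale p)⁻¹ n) ^ k := by simp
    have h := ((tendsto_integral_scaledWeight_pow p hp k).sub hcorr).div_const θ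
    have hlim : (limitMoment p k - 0) / θ
        = (k.factorial : ℝ) / Real.Gamma (k * (2 * p - 1) + 1) := by
      rw [limitMoment, if_neg hk, sub_zero, hθ_eq, mul_div_cancel_left₀ _ (hθ_eq ▸ hθ0.ne')]
    rwa [hlim] at h

theorem mainTheorem9 (p : unitInterval) (hp0 : 0 < (p : ℝ)) (hp1 : (p : ℝ) < 1) :
    ((p : ℝ) ≤ 1 / 2 →
      ∃ D : PMF ℕ, D 0 = 0 ∧
        (∀ m : ℕ, 1 ≤ m → D m = ENNReal.ofReal
          (1 / ((m : ℝ) + 1) * ((2 * m).choose m : ℝ) * (p : ℝ) ^ (m - 1)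
            * (1 - (p : ℝ)) ^ (m + 1))) ∧
        TendstoInDistribution
          (fun (n : ℕ) (N : GrowingNetwork (n + 1)) => (N.sourceDegree : ℝ))
          atTop (fun m : ℕ => (m : ℝ))
          (fun n : ℕ => (GrowingNetwork.saturationModel p n).toMeasure) D.toMeasure) ∧
    (∀ hp : 1 / 2 < (p : ℝ),
      (∃ ν : ProbabilityMeasure ℝ, IsMittagLeffler (2 * p - 1) ν) ∧
      ∀ ν : ProbabilityMeasure ℝ, IsMittagLeffler (2 * p - 1) ν →
        TendstoInDistribution
          (fun (n : ℕ) (N : GrowingNetwork (n + 1)) =>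
            (2 * (p : ℝ) - 1) ^ 2 / (p : ℝ) ^ 2
              * ((N.sourceDegree : ℝ) / ((n + 1 : ℕ) : ℝ) ^ (2 * (p : ℝ) - 1)))
          atTop (fun ω : ℝ × ℝ => ω.1 * ω.2)
          (fun n : ℕ => (GrowingNetwork.saturationModel p n).toMeasure)
          ((bernoulliMeasure (1 : ℝ) 0
            ⟨(2 * (p : ℝ) - 1) / (p : ℝ) ^ 2,
              two_mul_sub_one_div_sq_mem_unitInterval hp⟩).prod (ν : Measure ℝ))) := by
  refine ⟨fun hp => ⟨finalDegree p hp0 hp, ?_, fun m hm => ?_,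
    tendstoInDistribution_sourceDegree p hp0 hp⟩, fun hp => ⟨exists_isMittagLeffler p hp,
      fun ν hν => tendstoInDistribution_scaledDegree p hp hν⟩⟩
  · change ENNReal.ofReal (absorptionProb p 0 (1, 2)) = 0
    simp [absorptionProb]
  · change ENNReal.ofReal (absorptionProb p m (1, 2)) = _
    rw [absorptionProb_eq_choose _ hm]
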